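/- Let $0<\beta<1$ and $1\le\kappa\le 2$. For $0<\alpha<1$ let ${}_0I_x^{\alpha}w(x)=\frac1{\Gamma(\alpha)}\int_0^x\frac{w(s)}{(x-s)^{1-\alpha}}\,ds$ and ${}_xI_1^{\alpha}w(x)=\frac1{\Gamma(\alpha)}\int_x^1\frac{w(s)}{(s-x)^{1-\alpha}}\,ds$. The left and right Caputo derivatives of order $1-\beta/2$ are ${}^C_0D_x^{1-\beta/2}v={}_0I_x^{\beta/2}Dv$ and ${}^C_xD_1^{1-\beta/2}v={}_xI_1^{\beta/2}(-Dv)$, understood in the weak sense: $g={}^C_0D_x^{1-\beta/2}v$ and $h={}^C_xD_1^{1-\beta/2}v$ in $L^2(0,1)$ mean that for all $\psi\in C_0^\infty(0,1)$ $$\bigl(g,\;{}_xI_1^{1-\beta/2}(-D\psi)\bigr)_{L^2(0,1)}=-\int_0^1 v\,D\psi\,dx ,\qquad \bigl(h,\;{}_0I_x^{1-\beta/2}D\psi\bigr)_{L^2(0,1)}=\int_0^1 v\,D\psi\,dx .$$ Let $H=H^{1-\beta/2}_{C,l}(0,1)=\{v\in L^\kappa(0,1):{}^C_0D_x^{1-\beta/2}v\in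 L^2(0,1)\}$ with the norm $\|v\|_H=\bigl(\|v\|_{L^\kappa}^2+\|{}^C_0D_x^{1-\beta/2}v\|_{L^2}^2\bigr)^{1/2}$, and let $H^{0}=\{v\in H:\int_0^1 v\,dx=0\}$. For $f\in H'$ and $a_0,a_1\in\mathbb R$, a weak solution of the conservative Caputo equation $-D({}^C_0D_x^{1-\beta}u)=f$ on $(0,1)$ with Caputo fractional Neumann data $a_0$ at $x=0$ and $a_1$ at $x=1$ is a $u\in H$ such that $$B(u,v)=\langle f,v\rangle+a_1v(1)-a_0v(0)\quad\text{for all } v\in H,\qquad B(w,v):=-\bigl({}^C_0D_x^{1-\beta/2}w,\;{}^C_xD_1^{1-\beta/2}v\bigr)_{L^2(0,1)},$$ where $v(0),v(1)$ are values of the continuous representative of $v$ on $[0,1]$. Then the following hold. 1. The weak formulation is well defined: each $v\in H$ has exactly one left and exactly one right Caputo derivative of order $1-\beta/2$ in $L^2(0,1)$, and it has a representative continuous on $[0,1]$. 2. $B(w,w)\ge\cos(\beta\pi/2)\,\|{}^C_0D_x^{1-\beta/2}w\|_{L^2(0,1)}^2$ for all $w\in H$. 3. There is a constant $C>0$, depending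 only on $\beta$ and $\kappa$, such that for all $f\in H'$ and $a_0,a_1\in\mathbb R$ with $\langle f,1\rangle+a_1-a_0=0$ there is exactly one weak solution $u^*$ in $H^0$; it satisfies $$\|u^*\|_{H}\le C\bigl(\|f\|_{H'}+|a_0|+|a_1|\bigr),$$ and $u\in H$ is a weak solution if and only if $u=u^*+c$ for some constant $c\in\mathbb R$. -/

import Mathlib

open MeasureTheory Set
open scoped ENNReal ContDiff

namespace ConservativeCaputo

noncomputable section

/-- Lebesgue measure on the interval `(0,1)`. -/
abbrev vol01 : Measure ℝ := volume.restrict (Ioo (0 : ℝ) 1)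

/-- The left fractional integral `₀I_x^α w (x) = Γ(α)⁻¹ ∫_0^x w(s) (x-s)^{α-1} ds`. -/
def leftFracInt (α : ℝ) (w : ℝ → ℝ) (x : ℝ) : ℝ :=
  1 / Real.Gamma α * ∫ s in Ioo 0 x, w s / (x - s) ^ (1 - α)

/-- The right fractional integral `ₓI_1^α w (x) = Γ(α)⁻¹ ∫_x^1 w(s) (s-x)^{α-1} ds`. -/
def rightFracInt (α : ℝ) (w : ℝ → ℝ) (x : ℝ) : ℝ :=
  1 / Real.Gamma α * ∫ s in Ioo x 1, w s / (s - x) ^ (1 - α)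

/-- The left Caputo derivative of order `1 - α` of a smooth function, `₀I_x^α (D w)`. -/
def leftCaputo (α : ℝ) (w : ℝ → ℝ) : ℝ → ℝ :=
  leftFracInt α (deriv w)

/-- The right Caputo derivative of order `1 - α` of a smooth function, `ₓI_1^α (-D w)`. -/
def rightCaputo (α : ℝ) (w : ℝ → ℝ) : ℝ → ℝ :=
  rightFracInt α (fun s => -deriv w s)

/-- `ψ ∈ C_0^∞(0,1)`. -/
def IsTest (ψ : ℝ → ℝ) : Prop :=
  ContDiff ℝ ∞ ψ ∧ HasCompactSupport ψ ∧ tsupport ψ ⊆ Ioo 0 1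

/-- `g` is the left Caputo derivative `₀I_x^α (D v)`, of order `1 - α`, of `v` in the weak sense
(used for `0 < α < 1/2` and `g ∈ L²(0,1)`). As the right integral is the adjoint of the left one
and `ₓI_1^α` of the right Caputo derivative of order `α` of a test function `ψ` is `ψ` itself, the
condition `₀I_x^α (D v) = g` reads, for all `ψ ∈ C_0^∞(0,1)`,
`(g, ₓD_1^α ψ) = (D v, ψ) = -(v, D ψ)`.
The integrability is automatic for `α < 1` and `g ∈ L²(0,1)`, as `ₓD_1^α ψ` is then bounded. -/
def IsWeakLeftCaputo (α : ℝ) (v g : ℝ → ℝ) : Prop :=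
  ∀ ψ : ℝ → ℝ, IsTest ψ →
    Integrable (fun x => g x * rightCaputo (1 - α) ψ x) vol01 ∧
    ∫ x, g x * rightCaputo (1 - α) ψ x ∂vol01 = -∫ x, v x * deriv ψ x ∂vol01

/-- `h` is the right Caputo derivative `ₓI_1^α (-D v)`, of order `1 - α`, of `v` in the weak sense:
`(h, ₀D_x^α ψ) = (-D v, ψ) = (v, D ψ)` for all `ψ ∈ C_0^∞(0,1)`, where `₀D_x^α ψ` is the left
Caputo derivative of order `α`. -/
def IsWeakRightCaputo (α : ℝ) (v h : ℝ → ℝ) : Prop :=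
  ∀ ψ : ℝ → ℝ, IsTest ψ →
    Integrable (fun x => h x * leftCaputo (1 - α) ψ x) vol01 ∧
    ∫ x, h x * leftCaputo (1 - α) ψ x ∂vol01 = ∫ x, v x * deriv ψ x ∂vol01

theorem continuous_deriv_test {ψ : ℝ → ℝ} (hψ : IsTest ψ) : Continuous (deriv ψ) :=
  hψ.1.continuous_deriv (by simp)

theorem integral_deriv_test {ψ : ℝ → ℝ} (hψ : IsTest ψ) :
    ∫ x, deriv ψ x ∂vol01 = 0 := by
  have h0 : ψ 0 = 0 := image_eq_zero_of_notMem_tsupport fun h => lt_irrefl _ (hψ.2.2 h).1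
  have h1 : ψ 1 = 0 := image_eq_zero_of_notMem_tsupport fun h => lt_irrefl _ (hψ.2.2 h).2
  have h := intervalIntegral.integral_deriv_eq_sub' (a := 0) (b := 1) ψ rfl
    (fun x _ => (hψ.1.differentiable (by simp)).differentiableAt)
    (continuous_deriv_test hψ).continuousOn
  rw [intervalIntegral.integral_of_le zero_le_one, integral_Ioc_eq_integral_Ioo] at h
  simpa [h0, h1] using h

theorem integrable_mul_deriv_test {κ : ℝ≥0∞} [hκ : Fact (1 ≤ κ)] (v : Lp ℝ κ vol01)
    {ψ : ℝ → ℝ} (hψ : IsTest ψ) : Integrable (fun x => v x * deriv ψ x) vol01 := by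
  obtain ⟨C, hC⟩ := (hψ.2.1.deriv).exists_bound_of_continuous (continuous_deriv_test hψ)
  exact ((Lp.memLp v).integrable hκ.out).mul_bdd
    (continuous_deriv_test hψ).aestronglyMeasurable (.of_forall hC)

/-- The pairs `(v, g)` in `L^κ(0,1) × L²(0,1)` such that `g` is the left Caputo derivative of
order `1 - α` of `v`. For `0 < α < 1/2` the function `v` determines `g`, so that this is the left
Caputo fractional derivative space of order `1 - α`, `{v ∈ L^κ(0,1) : ₀D_x^{1-α} v ∈ L²(0,1)}`, and
its norm is `(‖v‖²_{L^κ} + ‖₀D_x^{1-α} v‖²_{L²})^{1/2}`. -/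
def CaputoSpace (κ : ℝ≥0∞) [Fact (1 ≤ κ)] (α : ℝ) :
    Submodule ℝ (WithLp 2 (Lp ℝ κ vol01 × Lp ℝ 2 vol01)) where
  carrier := {p | IsWeakLeftCaputo α p.fst p.snd}
  zero_mem' := by
    intro ψ hψ
    have h1 : (fun x => (0 : Lp ℝ 2 vol01) x * rightCaputo (1 - α) ψ x) =ᵐ[vol01] 0 := by
      filter_upwards [Lp.coeFn_zero ℝ 2 vol01] with x hx
      simp only [hx, Pi.zero_apply, zero_mul]
    have h2 : (fun x => (0 : Lp ℝ κ vol01) x * deriv ψ x) =ᵐ[vol01] 0 := by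
      filter_upwards [Lp.coeFn_zero ℝ κ vol01] with x hx
      simp only [hx, Pi.zero_apply, zero_mul]
    refine ⟨(integrable_congr h1).2 (integrable_zero ℝ ℝ vol01), ?_⟩
    rw [WithLp.zero_fst, WithLp.zero_snd, integral_congr_ae h1, integral_congr_ae h2]
    simp
  add_mem' := by
    intro p q hp hq ψ hψ
    have h1 : (fun x => (p.snd + q.snd) x * rightCaputo (1 - α) ψ x) =ᵐ[vol01]
        fun x => p.snd x * rightCaputo (1 - α) ψ x + q.snd x * rightCaputo (1 - α) ψ x := by
      filter_upwards [Lp.coeFn_add p.snd q.snd] with x hx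
      simp only [hx, Pi.add_apply, add_mul]
    have h2 : (fun x => (p.fst + q.fst) x * deriv ψ x) =ᵐ[vol01]
        fun x => p.fst x * deriv ψ x + q.fst x * deriv ψ x := by
      filter_upwards [Lp.coeFn_add p.fst q.fst] with x hx
      simp only [hx, Pi.add_apply, add_mul]
    refine ⟨(integrable_congr h1).2 ((hp ψ hψ).1.add (hq ψ hψ).1), ?_⟩
    rw [WithLp.add_fst, WithLp.add_snd, integral_congr_ae h1, integral_congr_ae h2,
      integral_add (hp ψ hψ).1 (hq ψ hψ).1, integral_add (integrable_mul_deriv_test _ hψ)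
      (integrable_mul_deriv_test _ hψ), (hp ψ hψ).2, (hq ψ hψ).2, neg_add]
  smul_mem' := by
    intro c p hp ψ hψ
    have h1 : (fun x => (c • p.snd) x * rightCaputo (1 - α) ψ x) =ᵐ[vol01]
        fun x => c * (p.snd x * rightCaputo (1 - α) ψ x) := by
      filter_upwards [Lp.coeFn_smul c p.snd] with x hx
      simp only [hx, Pi.smul_apply, smul_eq_mul, mul_assoc]
    have h2 : (fun x => (c • p.fst) x * deriv ψ x) =ᵐ[vol01]
        fun x => c * (p.fst x * deriv ψ x) := by
      filter_upwards [Lp.coeFn_smul c p.fst] with x hx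
      simp only [hx, Pi.smul_apply, smul_eq_mul, mul_assoc]
    refine ⟨(integrable_congr h1).2 ((hp ψ hψ).1.const_mul c), ?_⟩
    rw [WithLp.smul_fst, WithLp.smul_snd, integral_congr_ae h1, integral_congr_ae h2,
      integral_const_mul, integral_const_mul, (hp ψ hψ).2, mul_neg]

variable {κ : ℝ≥0∞} [Fact (1 ≤ κ)] {α : ℝ}

/-- The function underlying an element of the space, as an element of `L^κ(0,1)`. -/
def toFn (v : CaputoSpace κ α) : Lp ℝ κ vol01 := v.1.fst

/-- The left Caputo derivative `₀D_x^{1-α} v` of an element of the space, in `L²(0,1)`. -/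
def leftD (v : CaputoSpace κ α) : Lp ℝ 2 vol01 := v.1.snd

theorem norm_eq (v : CaputoSpace κ α) : ‖v‖ = √(‖toFn v‖ ^ 2 + ‖leftD v‖ ^ 2) :=
  WithLp.prod_norm_eq_of_L2 v.1

/-- `h ∈ L²(0,1)` is the right Caputo derivative `ₓD_1^{1-α} v`. -/
def HasRightD (v : CaputoSpace κ α) (h : Lp ℝ 2 vol01) : Prop :=
  IsWeakRightCaputo α (toFn v) h

open Classical in
/-- The right Caputo derivative `ₓD_1^{1-α} v ∈ L²(0,1)` (`0` if there is none). -/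
def rightD (v : CaputoSpace κ α) : Lp ℝ 2 vol01 :=
  if h : ∃ g, HasRightD v g then h.choose else 0

/-- `w` is a representative of `v` that is continuous on `[0,1]`. -/
def IsContRep (v : CaputoSpace κ α) (w : ℝ → ℝ) : Prop :=
  ContinuousOn w (Icc 0 1) ∧ toFn v =ᵐ[vol01] w

open Classical in
/-- The value at `x ∈ [0,1]` of the representative of `v` that is continuous on `[0,1]`
(`0` if there is none). -/
def valueAt (v : CaputoSpace κ α) (x : ℝ) : ℝ :=
  if h : ∃ w, IsContRep v w then h.choose x else 0

variable (κ α) in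
/-- The constant function `1`, as an element of the space. -/
def one : CaputoSpace κ α :=
  ⟨WithLp.toLp 2 (Lp.const κ vol01 (1 : ℝ), 0), by
    intro ψ hψ
    have h1 : (fun x => (0 : Lp ℝ 2 vol01) x * rightCaputo (1 - α) ψ x) =ᵐ[vol01] 0 := by
      filter_upwards [Lp.coeFn_zero ℝ 2 vol01] with x hx
      simp only [hx, Pi.zero_apply, zero_mul]
    have h2 : (fun x => (Lp.const κ vol01 (1 : ℝ)) x * deriv ψ x) =ᵐ[vol01] deriv ψ := by
      filter_upwards [Lp.coeFn_const κ vol01 (1 : ℝ)] with x hx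
      simp only [hx, Function.const_apply, one_mul]
    refine ⟨(integrable_congr h1).2 (integrable_zero ℝ ℝ vol01), ?_⟩
    refine (integral_congr_ae h1).trans ?_
    refine Eq.trans ?_ (congrArg Neg.neg (integral_congr_ae h2)).symm
    rw [integral_deriv_test hψ]
    simp⟩

/-- `∫_0^1 v dx = 0`. -/
def IsMeanZero (v : CaputoSpace κ α) : Prop :=
  ∫ x, toFn v x ∂vol01 = 0

/-- The form `B(w, v) = -(₀D_x^{1-α} w, ₓD_1^{1-α} v)_{L²(0,1)}`. -/
def formB (w v : CaputoSpace κ α) : ℝ :=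
  -inner ℝ (leftD w) (rightD v)

/-- `u` is a weak solution of `-D(₀I_x^{2α} D u) = f` with boundary data `a₀, a₁`:
`B(u, v) = ⟨f, v⟩ + a₁ v(1) - a₀ v(0)` for all `v` in the space. -/
def IsWeakSolution (f : CaputoSpace κ α →L[ℝ] ℝ) (a₀ a₁ : ℝ) (u : CaputoSpace κ α) : Prop :=
  ∀ v : CaputoSpace κ α, formB u v = f v + a₁ * valueAt v 1 - a₀ * valueAt v 0

end

end ConservativeCaputo

/-!
Write `a = β/2 ∈ (0, 1/2)`, and `I_+^α`, `I_-^α` for the left and right fractional integrals. By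
Fubini and the lemma of du Bois-Reymond, `g ∈ L²` is the left Caputo derivative of `v` exactly
when `v = I_+^{1-a} g + c` almost everywhere, and `h` is the right one exactly when
`v = I_-^{1-a} h + c` (`isWeakLeftCaputo_iff`, `isWeakRightCaputo_iff`). So the space is
parametrised by `L² × ℝ`; that `v` determines `g` and `h` is
`ae_eq_zero_of_leftInt_ae_eq_const` and its mirror image, and since `1 - a > 1/2` the function
`I_+^{1-a} g` is continuous.

The analytic core is the existence of the right derivative together with coercivity. For a test
function `φ` the primitives of `φ` have left derivative `I_+^a φ` and right derivative `-I_-^a φ`,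
by the semigroup property. Extending `φ` by zero to the line and computing with the
Riemann–Liouville kernel (Beta integral, Laplace transform, reflection formula) gives
`(I_+^a φ, I_-^a φ) = cos(πa) ‖I_+^a φ‖²_{L²(ℝ)} = cos(πa) ‖I_-^a φ‖²_{L²(ℝ)}`
(`integral_leftInt_mul_rightInt`), and the left-hand side is an integral over `(0,1)` only. The
first expression yields coercivity; the second, with Cauchy–Schwarz, bounds the right derivative
by `1 / cos(πa)` times the left one on `(0,1)`. As the functions `I_+^a φ` are dense in `L²(0,1)`
(`dense_fst_testPairs`), there is a bounded operator `T` on `L²(0,1)` sending left to right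
derivatives, with `-T` coercive (`exists_leftToRight`).

Now `B(w, v) = -(D w, T (D v))` depends only on left derivatives, and the right-hand side of the
weak formulation does so as well, because by the compatibility condition it vanishes on constants.
The theorem of Lax–Milgram on `L²(0,1)` (`exists_lax_milgram`) gives the left derivative of the
solution, and a bounded right inverse of the left derivative with values of mean zero
(`exists_rightInverse`) gives the solution itself.
-/

namespace ConservativeCaputo

/-! ### The fractional integration kernel -/

/-- The Riemann–Liouville kernel `y ↦ y₊^{α-1} / Γ(α)`, extended by zero to `y ≤ 0`. -/
noncomputable def fracKer (α y : ℝ) : ℝ :=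
  if 0 < y then y ^ (α - 1) / Real.Gamma α else 0

theorem fracKer_of_pos {α y : ℝ} (hy : 0 < y) :
    fracKer α y = y ^ (α - 1) / Real.Gamma α := if_pos hy

theorem fracKer_of_nonpos {α y : ℝ} (hy : y ≤ 0) : fracKer α y = 0 := if_neg hy.not_gt

theorem fracKer_nonneg {α : ℝ} (hα : 0 < α) (y : ℝ) : 0 ≤ fracKer α y := by
  unfold fracKer
  split_ifs with h
  · have := Real.Gamma_pos_of_pos hα
    positivity
  · exact le_rfl

@[fun_prop]
theorem measurable_fracKer (α : ℝ) : Measurable (fracKer α) :=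
  Measurable.ite measurableSet_Ioi (by fun_prop) measurable_const

theorem fracKer_one {y : ℝ} (hy : 0 < y) : fracKer 1 y = 1 := by
  simp [fracKer_of_pos hy]

theorem integral_betaPDFReal {a b : ℝ} (ha : 0 < a) (hb : 0 < b) :
    ∫ x, ProbabilityTheory.betaPDFReal a b x = 1 := by
  rw [integral_eq_lintegral_of_nonneg_ae]
  · have := ProbabilityTheory.lintegral_betaPDF_eq_one ha hb
    simp only [ProbabilityTheory.betaPDF] at this
    rw [this, ENNReal.toReal_one]
  · refine .of_forall fun x => ?_
    by_cases hx : 0 < x ∧ x < 1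
    · exact (ProbabilityTheory.betaPDFReal_pos hx.1 hx.2 ha hb).le
    · simp [ProbabilityTheory.betaPDFReal, hx]
  · exact (ProbabilityTheory.stronglyMeasurable_betaPDFReal a b).aestronglyMeasurable

/-- The semigroup property `k_a ⋆ k_b = k_{a+b}`, from Euler's Beta integral. -/
theorem integral_fracKer_mul_fracKer {a b : ℝ} (ha : 0 < a) (hb : 0 < b) (s t : ℝ) :
    ∫ x, fracKer a (t - x) * fracKer b (x - s) = fracKer (a + b) (t - s) := by
  rcases le_or_gt t s with hts | hst
  · rw [fracKer_of_nonpos (by linarith), ← integral_zero ℝ ℝ]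
    refine integral_congr_ae (.of_forall fun x => ?_)
    rcases le_or_gt t x with h | h
    · simp [fracKer_of_nonpos (sub_nonpos.2 h)]
    · simp [fracKer_of_nonpos (α := b) (y := x - s) (by linarith)]
  have hd : 0 < t - s := sub_pos.2 hst
  have key : ∀ x, fracKer a (t - x) * fracKer b (x - s) = (t - s) ^ (a + b - 2) /
      Real.Gamma (a + b) * ProbabilityTheory.betaPDFReal b a ((x - s) / (t - s)) := by
    intro x
    have hGa := Real.Gamma_pos_of_pos ha
    have hGb := Real.Gamma_pos_of_pos hb
    have hGab := Real.Gamma_pos_of_pos (add_pos ha hb)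
    by_cases hx : s < x ∧ x < t
    · have h1 : 0 < x - s := by linarith
      have h2 : 0 < t - x := by linarith
      have h3 : 1 - (x - s) / (t - s) = (t - x) / (t - s) := by field_simp; ring
      have h4 : (x - s) / (t - s) < 1 := by rw [div_lt_one hd]; linarith
      rw [fracKer_of_pos h1, fracKer_of_pos h2, ProbabilityTheory.betaPDFReal,
        if_pos ⟨div_pos h1 hd, h4⟩, h3, Real.div_rpow h1.le hd.le, Real.div_rpow h2.le hd.le,
        ProbabilityTheory.beta, show a + b - 2 = (b - 1) + (a - 1) by ring,
        Real.rpow_add hd, add_comm b a]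
      field_simp
    · have h4 : ¬ (0 < (x - s) / (t - s) ∧ (x - s) / (t - s) < 1) := by
        rw [div_lt_one hd, div_pos_iff_of_pos_right hd]
        intro h
        exact hx ⟨by linarith [h.1], by linarith [h.2]⟩
      rw [ProbabilityTheory.betaPDFReal, if_neg h4, mul_zero]
      rcases not_and_or.1 hx with h | h
      · rw [fracKer_of_nonpos (α := b) (y := x - s) (by linarith), mul_zero]
      · rw [fracKer_of_nonpos (α := a) (y := t - x) (by linarith), zero_mul]
  simp_rw [key]
  rw [integral_const_mul,
    integral_sub_right_eq_self (fun x => ProbabilityTheory.betaPDFReal b a (x / (t - s))) s,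
    Measure.integral_comp_div, integral_betaPDFReal hb ha, fracKer_of_pos hd, abs_of_pos hd,
    show a + b - 1 = (a + b - 2) + 1 by ring, Real.rpow_add_one hd.ne']
  simp only [smul_eq_mul]
  ring

theorem integrable_fracKer_mul_fracKer {a b : ℝ} (ha : 0 < a) (hb : 0 < b) (s t : ℝ) :
    Integrable fun x => fracKer a (t - x) * fracKer b (x - s) := by
  rcases le_or_gt t s with hts | hst
  · refine (integrable_zero ℝ ℝ volume).congr (.of_forall fun x => ?_)
    rcases le_or_gt t x with h | h
    · simp [fracKer_of_nonpos (sub_nonpos.2 h)]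
    · simp [fracKer_of_nonpos (α := b) (y := x - s) (by linarith)]
  · refine .of_integral_ne_zero ?_
    have hG := Real.Gamma_pos_of_pos (add_pos ha hb)
    have hd : 0 < t - s := sub_pos.2 hst
    rw [integral_fracKer_mul_fracKer ha hb, fracKer_of_pos hd]
    positivity

/-- The Laplace transform of the kernel. -/
theorem lintegral_fracKer_mul_exp {a r : ℝ} (ha : 0 < a) (hr : 0 < r) :
    ∫⁻ y, ENNReal.ofReal (fracKer a y * Real.exp (-(r * y))) = ENNReal.ofReal (r ^ (-a)) := by
  have hG := Real.Gamma_pos_of_pos ha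
  have h1 : ∫ y, fracKer a y * Real.exp (-(r * y)) = r ^ (-a) := by
    have h2 : (fun y => fracKer a y * Real.exp (-(r * y))) = (Ioi 0).indicator
        fun y => (Real.Gamma a)⁻¹ * (y ^ (a - 1) * Real.exp (-(r * y))) := by
      ext y
      by_cases hy : 0 < y
      · rw [indicator_of_mem (mem_Ioi.2 hy), fracKer_of_pos hy]
        ring
      · rw [indicator_of_notMem (by simpa using hy), fracKer_of_nonpos (not_lt.1 hy), zero_mul]
    rw [h2, integral_indicator measurableSet_Ioi, integral_const_mul,
      Real.integral_rpow_mul_exp_neg_mul_Ioi ha hr, one_div, Real.inv_rpow hr.le,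
      Real.rpow_neg hr.le]
    field_simp
  rw [← h1, ofReal_integral_eq_lintegral_ofReal]
  · refine .of_integral_ne_zero ?_
    rw [h1]
    positivity
  · exact .of_forall fun y => mul_nonneg (fracKer_nonneg ha y) (Real.exp_pos _).le

theorem cos_pi_mul_pos {a : ℝ} (ha : 0 < a) (ha' : a < 1 / 2) : 0 < Real.cos (Real.pi * a) :=
  Real.cos_pos_of_mem_Ioo ⟨by nlinarith [Real.pi_pos], by nlinarith [Real.pi_pos]⟩

/-- The autocorrelation of the kernel. Its constant comes from writing `(y+d)^{a-1}` as a Laplace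
transform, and simplifies by Euler's reflection formula. -/
theorem lintegral_fracKer_mul_fracKer_add {a d : ℝ} (ha : 0 < a) (ha' : a < 1 / 2) (hd : 0 < d) :
    ∫⁻ y, ENNReal.ofReal (fracKer a y * fracKer a (y + d)) =
      ENNReal.ofReal (fracKer (2 * a) d / (2 * Real.cos (Real.pi * a))) := by
  have h1 : ∀ y, ENNReal.ofReal (fracKer a y * fracKer a (y + d)) =
      ∫⁻ r, ENNReal.ofReal ((Real.Gamma a)⁻¹ *
        (fracKer (1 - a) r * Real.exp (-(r * d)) * (fracKer a y * Real.exp (-(r * y))))) := by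
    intro y
    have hG := Real.Gamma_pos_of_pos ha
    by_cases hy : 0 < y
    · have hyd : 0 < y + d := by linarith
      have h2 : ∀ r, ENNReal.ofReal ((Real.Gamma a)⁻¹ *
          (fracKer (1 - a) r * Real.exp (-(r * d)) * (fracKer a y * Real.exp (-(r * y))))) =
          ENNReal.ofReal ((Real.Gamma a)⁻¹ * fracKer a y) *
            ENNReal.ofReal (fracKer (1 - a) r * Real.exp (-((y + d) * r))) := by
        intro r
        rw [← ENNReal.ofReal_mul (mul_nonneg (inv_nonneg.2 hG.le) (fracKer_nonneg ha y)),
          show -((y + d) * r) = -(r * d) + -(r * y) by ring, Real.exp_add]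
        congr 1
        ring
      simp_rw [h2]
      rw [lintegral_const_mul' _ _ ENNReal.ofReal_ne_top,
        lintegral_fracKer_mul_exp (by linarith) hyd, ← ENNReal.ofReal_mul
        (mul_nonneg (inv_nonneg.2 hG.le) (fracKer_nonneg ha y)), fracKer_of_pos hyd,
        neg_sub]
      congr 1
      ring
    · simp [fracKer_of_nonpos (not_lt.1 hy)]
  simp_rw [h1]
  rw [lintegral_lintegral_swap (by fun_prop)]
  have hG1 := Real.Gamma_pos_of_pos ha
  have hG2 := Real.Gamma_pos_of_pos (s := 1 - a) (by linarith)
  have hG3 := Real.Gamma_pos_of_pos (s := 1 - 2 * a) (by linarith)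
  have hG4 := Real.Gamma_pos_of_pos (s := 2 * a) (by linarith)
  have h3 : ∀ r, ∫⁻ y, ENNReal.ofReal ((Real.Gamma a)⁻¹ *
      (fracKer (1 - a) r * Real.exp (-(r * d)) * (fracKer a y * Real.exp (-(r * y))))) =
      ENNReal.ofReal (Real.Gamma (1 - 2 * a) / (Real.Gamma a * Real.Gamma (1 - a))) *
        ENNReal.ofReal (fracKer (1 - 2 * a) r * Real.exp (-(d * r))) := by
    intro r
    by_cases hr : 0 < r
    · have h0 : 0 ≤ (Real.Gamma a)⁻¹ * (fracKer (1 - a) r * Real.exp (-(r * d))) :=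
        mul_nonneg (inv_nonneg.2 hG1.le)
          (mul_nonneg (fracKer_nonneg (by linarith) r) (Real.exp_pos _).le)
      simp only [← mul_assoc] at h0 ⊢
      simp_rw [mul_assoc (_ * _ * _) (fracKer a _), ENNReal.ofReal_mul h0]
      rw [lintegral_const_mul' _ _ ENNReal.ofReal_ne_top, lintegral_fracKer_mul_exp ha hr,
        ← ENNReal.ofReal_mul h0, ← ENNReal.ofReal_mul (by positivity), fracKer_of_pos hr,
        fracKer_of_pos hr, show 1 - 2 * a - 1 = (1 - a - 1) + -a by ring, Real.rpow_add hr,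
        mul_comm d r]
      congr 1
      generalize Real.Gamma (1 - 2 * a) = G at hG3 ⊢
      field_simp
    · simp [fracKer_of_nonpos (not_lt.1 hr)]
  simp_rw [h3]
  rw [lintegral_const_mul' _ _ ENNReal.ofReal_ne_top,
    lintegral_fracKer_mul_exp (by linarith) hd, ← ENNReal.ofReal_mul (by positivity),
    fracKer_of_pos hd, neg_sub]
  congr 1
  have hs : 0 < Real.sin (Real.pi * a) := Real.sin_pos_of_pos_of_lt_pi (by positivity)
    (by nlinarith [Real.pi_pos])
  have hc : 0 < Real.cos (Real.pi * a) := cos_pi_mul_pos ha ha'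
  have e1 := Real.Gamma_mul_Gamma_one_sub a
  have e2 := Real.Gamma_mul_Gamma_one_sub (2 * a)
  rw [show Real.pi * (2 * a) = 2 * (Real.pi * a) by ring, Real.sin_two_mul] at e2
  have e3 : Real.Gamma (1 - 2 * a) =
      Real.pi / (2 * Real.sin (Real.pi * a) * Real.cos (Real.pi * a)) / Real.Gamma (2 * a) := by
    rw [← e2]; field_simp
  rw [e1, e3]
  have := Real.pi_pos
  field_simp

theorem integral_fracKer_mul_fracKer_add {a d : ℝ} (ha : 0 < a) (ha' : a < 1 / 2) (hd : 0 < d) :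
    ∫ y, fracKer a y * fracKer a (y + d) =
      fracKer (2 * a) d / (2 * Real.cos (Real.pi * a)) := by
  have hc : 0 < Real.cos (Real.pi * a) := cos_pi_mul_pos ha ha'
  rw [integral_eq_lintegral_of_nonneg_ae, lintegral_fracKer_mul_fracKer_add ha ha' hd,
    ENNReal.toReal_ofReal]
  · exact div_nonneg (fracKer_nonneg (by linarith) d) (by positivity)
  · exact .of_forall fun y => mul_nonneg (fracKer_nonneg ha y) (fracKer_nonneg ha _)
  · exact Measurable.aestronglyMeasurable (by fun_prop)

/-- On the whole line the kernel of `I_-^a I_+^a` is a multiple of the symmetrised kernel of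
`I_+^{2a}`. -/
theorem integral_fracKer_sub_mul_fracKer_sub {a : ℝ} (ha : 0 < a) (ha' : a < 1 / 2) {s t : ℝ}
    (hst : s ≠ t) : ∫ x, fracKer a (x - s) * fracKer a (x - t) =
      (fracKer (2 * a) (t - s) + fracKer (2 * a) (s - t)) / (2 * Real.cos (Real.pi * a)) := by
  wlog h : s < t generalizing s t
  · rw [add_comm, ← this hst.symm (lt_of_le_of_ne (not_lt.1 h) hst.symm)]
    simp_rw [mul_comm]
  rw [fracKer_of_nonpos (y := s - t) (by linarith), add_zero,
    ← integral_fracKer_mul_fracKer_add ha ha' (sub_pos.2 h),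
    ← integral_sub_right_eq_self (fun y => fracKer a y * fracKer a (y + (t - s))) t]
  refine integral_congr_ae (.of_forall fun x => ?_)
  simp only [show x - t + (t - s) = x - s by ring]
  ring

theorem integral_fracKer_sub_mul_fracKer_sub' {a : ℝ} (ha : 0 < a) (ha' : a < 1 / 2) {s t : ℝ}
    (hst : s ≠ t) : ∫ x, fracKer a (s - x) * fracKer a (t - x) =
      (fracKer (2 * a) (t - s) + fracKer (2 * a) (s - t)) / (2 * Real.cos (Real.pi * a)) := by
  have h := integral_fracKer_sub_mul_fracKer_sub ha ha' (s := -s) (t := -t)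
    (fun h => hst (neg_injective h))
  rw [add_comm, show s - t = -t - -s by ring, show t - s = -s - -t by ring, ← h,
    ← integral_neg_eq_self]
  refine integral_congr_ae (.of_forall fun x => ?_)
  simp only [show s - -x = x - -s by ring, show t - -x = x - -t by ring]

/-! ### Fractional integrals of functions on the unit interval -/

/-- The left fractional integral of the extension of `w|_(0,1)` by zero, at every `x ∈ ℝ`. Unlike
`leftFracInt` it does not see the values of `w` outside `(0,1)`; its tail on `(1,∞)` matters for
the energy identity. -/
noncomputable def leftInt (α : ℝ) (w : ℝ → ℝ) (x : ℝ) : ℝ :=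
  ∫ s, fracKer α (x - s) * w s ∂vol01

/-- The right fractional integral of the extension of `w|_(0,1)` by zero, at every `x ∈ ℝ`. -/
noncomputable def rightInt (α : ℝ) (w : ℝ → ℝ) (x : ℝ) : ℝ :=
  ∫ s, fracKer α (s - x) * w s ∂vol01

theorem leftFracInt_eq_leftInt (α : ℝ) (w : ℝ → ℝ) {x : ℝ} (hx : x ≤ 1) :
    leftFracInt α w x = leftInt α w x := by
  have h : ∀ s, (Ioo 0 1).indicator (fun s => fracKer α (x - s) * w s) s =
      (Ioo 0 x).indicator (fun s => 1 / Real.Gamma α * (w s / (x - s) ^ (1 - α))) s := by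
    intro s
    by_cases hs : s ∈ Ioo 0 x
    · have h1 : 0 < x - s := sub_pos.2 hs.2
      have h2 : s ∈ Ioo (0 : ℝ) 1 := ⟨hs.1, hs.2.trans_le hx⟩
      rw [indicator_of_mem hs, indicator_of_mem h2, fracKer_of_pos h1,
        show α - 1 = -(1 - α) by ring, Real.rpow_neg h1.le]
      ring
    · rw [indicator_of_notMem hs]
      by_cases hs' : s ∈ Ioo 0 1
      · rw [indicator_of_mem hs', fracKer_of_nonpos, zero_mul]
        by_contra h
        exact hs ⟨hs'.1, by linarith⟩
      · rw [indicator_of_notMem hs']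
  rw [leftFracInt, leftInt, ← integral_const_mul, ← integral_indicator measurableSet_Ioo,
    ← integral_indicator measurableSet_Ioo]
  exact (integral_congr_ae (.of_forall h)).symm

theorem rightFracInt_eq_rightInt (α : ℝ) (w : ℝ → ℝ) {x : ℝ} (hx : 0 ≤ x) :
    rightFracInt α w x = rightInt α w x := by
  have h : ∀ s, (Ioo 0 1).indicator (fun s => fracKer α (s - x) * w s) s =
      (Ioo x 1).indicator (fun s => 1 / Real.Gamma α * (w s / (s - x) ^ (1 - α))) s := by
    intro s
    by_cases hs : s ∈ Ioo x 1
    · have h1 : 0 < s - x := sub_pos.2 hs.1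
      have h2 : s ∈ Ioo (0 : ℝ) 1 := ⟨hx.trans_lt hs.1, hs.2⟩
      rw [indicator_of_mem hs, indicator_of_mem h2, fracKer_of_pos h1,
        show α - 1 = -(1 - α) by ring, Real.rpow_neg h1.le]
      ring
    · rw [indicator_of_notMem hs]
      by_cases hs' : s ∈ Ioo 0 1
      · rw [indicator_of_mem hs', fracKer_of_nonpos, zero_mul]
        by_contra h
        exact hs ⟨by linarith, hs'.2⟩
      · rw [indicator_of_notMem hs']
  rw [rightFracInt, rightInt, ← integral_const_mul, ← integral_indicator measurableSet_Ioo,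
    ← integral_indicator measurableSet_Ioo]
  exact (integral_congr_ae (.of_forall h)).symm

theorem measurePreserving_reflect :
    MeasurePreserving (fun x : ℝ => 1 - x) vol01 vol01 := by
  have h := (Measure.measurePreserving_sub_left (volume : Measure ℝ) 1).restrict_preimage
    (measurableSet_Ioo (a := (0 : ℝ)) (b := 1))
  have h1 : (fun x : ℝ => 1 - x) ⁻¹' Ioo 0 1 = Ioo 0 1 := by
    ext x
    simp only [mem_preimage, mem_Ioo]
    constructor <;> rintro ⟨h1, h2⟩ <;> constructor <;> linarith
  rwa [h1] at h

theorem integral_reflect (f : ℝ → ℝ) : ∫ x, f (1 - x) ∂vol01 = ∫ x, f x ∂vol01 :=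
  measurePreserving_reflect.integral_comp (Homeomorph.subLeft (1 : ℝ)).measurableEmbedding f

theorem rightInt_eq_leftInt_reflect (α : ℝ) (w : ℝ → ℝ) (x : ℝ) :
    rightInt α w x = leftInt α (fun s => w (1 - s)) (1 - x) := by
  rw [rightInt, leftInt, ← integral_reflect]
  simp only [show ∀ s, 1 - s - x = 1 - x - s by intro s; ring]

theorem leftInt_congr {α : ℝ} {w w' : ℝ → ℝ} (h : w =ᵐ[vol01] w') (x : ℝ) :
    leftInt α w x = leftInt α w' x :=
  integral_congr_ae (by filter_upwards [h] with s hs; rw [hs])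

theorem rightInt_congr {α : ℝ} {w w' : ℝ → ℝ} (h : w =ᵐ[vol01] w') (x : ℝ) :
    rightInt α w x = rightInt α w' x :=
  integral_congr_ae (by filter_upwards [h] with s hs; rw [hs])

theorem leftInt_of_nonpos {α : ℝ} (w : ℝ → ℝ) {x : ℝ} (hx : x ≤ 0) : leftInt α w x = 0 := by
  rw [leftInt, ← integral_zero ℝ ℝ]
  refine setIntegral_congr_fun measurableSet_Ioo fun s hs => ?_
  simp only [fracKer_of_nonpos (show x - s ≤ 0 by linarith [hs.1]), zero_mul]

theorem rightInt_of_one_le {α : ℝ} (w : ℝ → ℝ) {x : ℝ} (hx : 1 ≤ x) : rightInt α w x = 0 := by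
  rw [rightInt_eq_leftInt_reflect, leftInt_of_nonpos _ (by linarith)]

theorem integral_vol01_eq {f : ℝ → ℝ} (hf : ∀ x ∉ Ioo (0 : ℝ) 1, f x = 0) :
    ∫ x, f x ∂vol01 = ∫ x, f x :=
  setIntegral_eq_integral_of_forall_compl_eq_zero hf

/-- The mass of the kernel on `(0,1)`, as a function of the right endpoint. -/
theorem integral_fracKer_sub_left {α : ℝ} (hα : 0 < α) {x : ℝ} (hx : x ≤ 1) :
    Integrable (fun s => fracKer α (x - s)) vol01 ∧
      ∫ s, fracKer α (x - s) ∂vol01 = fracKer (α + 1) x := by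
  have h : ∀ s ∈ Ioo (0 : ℝ) 1, fracKer α (x - s) * fracKer 1 (s - 0) = fracKer α (x - s) := by
    intro s hs
    rw [sub_zero, fracKer_one hs.1, mul_one]
  constructor
  · exact (integrable_fracKer_mul_fracKer hα one_pos 0 x).integrableOn.congr_fun
      h measurableSet_Ioo
  · rw [← setIntegral_congr_fun measurableSet_Ioo h, integral_vol01_eq,
      integral_fracKer_mul_fracKer hα one_pos, sub_zero]
    intro s hs
    by_cases h0 : 0 < s
    · rw [fracKer_of_nonpos, zero_mul]
      have : 1 ≤ s := by by_contra h; exact hs ⟨h0, not_le.1 h⟩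
      linarith
    · rw [fracKer_of_nonpos (y := s - 0) (by linarith), mul_zero]

theorem integral_fracKer_sub_right {α : ℝ} (hα : 0 < α) {s : ℝ} (hs : 0 ≤ s) :
    Integrable (fun x => fracKer α (x - s)) vol01 ∧
      ∫ x, fracKer α (x - s) ∂vol01 = fracKer (α + 1) (1 - s) := by
  have h := integral_fracKer_sub_left hα (x := 1 - s) (by linarith)
  have e : ∀ x, fracKer α (1 - s - (1 - x)) = fracKer α (x - s) := by
    intro x; congr 1; ring
  constructor
  · have := measurePreserving_reflect.integrable_comp_of_integrable h.1
    exact this.congr (.of_forall e)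
  · rw [← h.2, ← integral_reflect (fun y => fracKer α (1 - s - y))]
    simp only [e]

theorem fracKer_add_one_le {α x : ℝ} (hα : 0 < α) (hx : x ≤ 1) :
    fracKer (α + 1) x ≤ 1 / Real.Gamma (α + 1) := by
  have hG := Real.Gamma_pos_of_pos (s := α + 1) (by linarith)
  rcases le_or_gt x 0 with h | h
  · rw [fracKer_of_nonpos h]
    positivity
  · rw [fracKer_of_pos h, add_sub_cancel_right]
    gcongr
    exact Real.rpow_le_one h.le hx hα.le

theorem integrable_fracKer_sub_mul {α : ℝ} (hα : 0 < α) {g : ℝ → ℝ} (hg : Integrable g vol01) :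
    Integrable (fun p : ℝ × ℝ => fracKer α (p.1 - p.2) * g p.2) (vol01.prod vol01) := by
  rw [integrable_prod_iff']
  · constructor
    · filter_upwards [ae_restrict_mem measurableSet_Ioo] with s hs
      exact (integral_fracKer_sub_right hα hs.1.le).1.mul_const _
    · refine (hg.norm.const_mul (1 / Real.Gamma (α + 1))).mono' ?_ ?_
      · refine AEStronglyMeasurable.integral_prod_right' (μ := vol01) (ν := vol01)
          (f := fun p : ℝ × ℝ => ‖fracKer α (p.2 - p.1) * g p.1‖) ?_
        exact ((by fun_prop : Measurable fun p : ℝ × ℝ =>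
          fracKer α (p.2 - p.1)).aestronglyMeasurable.mul hg.1.comp_fst).norm
      · filter_upwards [ae_restrict_mem measurableSet_Ioo] with s hs
        simp_rw [norm_mul, Real.norm_of_nonneg (fracKer_nonneg hα _)]
        rw [integral_mul_const, (integral_fracKer_sub_right hα hs.1.le).2, norm_mul, norm_norm,
          Real.norm_of_nonneg (fracKer_nonneg (by linarith) _)]
        gcongr
        exact fracKer_add_one_le hα (by linarith [hs.1])
  · exact (by fun_prop : Measurable fun p : ℝ × ℝ =>
      fracKer α (p.1 - p.2)).aestronglyMeasurable.mul hg.1.comp_snd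

theorem integrable_leftInt {α : ℝ} (hα : 0 < α) {g : ℝ → ℝ} (hg : Integrable g vol01) :
    Integrable (leftInt α g) vol01 :=
  (integrable_fracKer_sub_mul hα hg).integral_prod_left

theorem integrable_rightInt {α : ℝ} (hα : 0 < α) {g : ℝ → ℝ} (hg : Integrable g vol01) :
    Integrable (rightInt α g) vol01 := by
  have h := integrable_leftInt hα (measurePreserving_reflect.integrable_comp_of_integrable hg)
  refine (measurePreserving_reflect.integrable_comp_of_integrable h).congr (.of_forall fun x => ?_)
  exact (rightInt_eq_leftInt_reflect α g x).symm

/-- The right fractional integral is the adjoint of the left one. -/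
theorem integral_leftInt_mul {α : ℝ} (hα : 0 < α) {g φ : ℝ → ℝ} (hg : Integrable g vol01)
    (hφ : AEStronglyMeasurable φ vol01) {C : ℝ} (hC : ∀ x, |φ x| ≤ C) :
    Integrable (fun x => g x * rightInt α φ x) vol01 ∧
      ∫ x, leftInt α g x * φ x ∂vol01 = ∫ x, g x * rightInt α φ x ∂vol01 := by
  have h : Integrable (fun p : ℝ × ℝ => fracKer α (p.1 - p.2) * g p.2 * φ p.1)
      (vol01.prod vol01) :=
    (integrable_fracKer_sub_mul hα hg).mul_bdd hφ.comp_fst (.of_forall fun p => hC p.1)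
  have e : ∀ s, g s * rightInt α φ s = ∫ x, fracKer α (x - s) * g s * φ x ∂vol01 := by
    intro s
    rw [rightInt, ← integral_const_mul]
    refine integral_congr_ae (.of_forall fun x => ?_)
    simp only
    ring
  constructor
  · simp_rw [e]
    exact h.integral_prod_right
  · simp_rw [e]
    rw [← integral_integral_swap h]
    refine integral_congr_ae (.of_forall fun x => ?_)
    simp only [leftInt]
    rw [integral_mul_const]

theorem integral_rightInt_mul {α : ℝ} (hα : 0 < α) {g φ : ℝ → ℝ} (hg : Integrable g vol01)
    (hφ : AEStronglyMeasurable φ vol01) {C : ℝ} (hC : ∀ x, |φ x| ≤ C) :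
    Integrable (fun x => g x * leftInt α φ x) vol01 ∧
      ∫ x, rightInt α g x * φ x ∂vol01 = ∫ x, g x * leftInt α φ x ∂vol01 := by
  have h := integral_leftInt_mul hα (measurePreserving_reflect.integrable_comp_of_integrable hg)
    (hφ.comp_measurePreserving measurePreserving_reflect) (fun x => hC (1 - x))
  have e : ∀ x, (g ∘ fun x => 1 - x) (1 - x) * rightInt α (φ ∘ fun x => 1 - x) (1 - x) =
      g x * leftInt α φ x := by
    intro x
    simp [rightInt_eq_leftInt_reflect]
  constructor
  · exact (measurePreserving_reflect.integrable_comp_of_integrable h.1).congr (.of_forall e)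
  · have h2 := h.2
    rw [← integral_reflect (fun x => (g ∘ fun x => 1 - x) x * _)] at h2
    simp only [e] at h2
    rw [← h2, ← integral_reflect]
    simp [rightInt_eq_leftInt_reflect, Function.comp_def]

/-- The semigroup property of the left integrals, when the total order is one. -/
theorem leftInt_leftInt {a b : ℝ} (ha : 0 < a) (hb : 0 < b) (hab : b + a = 1) {w : ℝ → ℝ}
    (hw : Integrable w vol01) {x : ℝ} (hx : x ≤ 1) :
    leftInt b (leftInt a w) x = leftInt 1 w x := by
  have h0 : ∀ s ∈ Ioo (0 : ℝ) 1, ∫ y, fracKer b (x - y) * fracKer a (y - s) ∂vol01 =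
      fracKer 1 (x - s) := by
    intro s hs
    rw [integral_vol01_eq, integral_fracKer_mul_fracKer hb ha, hab]
    intro y hy
    by_cases hy0 : 0 < y
    · rw [fracKer_of_nonpos (y := x - y), zero_mul]
      have : 1 ≤ y := by by_contra h; exact hy ⟨hy0, not_le.1 h⟩
      linarith
    · rw [fracKer_of_nonpos (y := y - s) (by linarith [hs.1]), mul_zero]
  have hmeas : Measurable fun p : ℝ × ℝ => fracKer b (x - p.1) * fracKer a (p.1 - p.2) := by
    fun_prop
  have hk : ∀ y, fracKer 1 y ≤ 1 := by
    intro y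
    rcases le_or_gt y 0 with h | h
    · rw [fracKer_of_nonpos h]; exact zero_le_one
    · rw [fracKer_one h]
  have hint : Integrable (fun p : ℝ × ℝ => fracKer b (x - p.1) * fracKer a (p.1 - p.2) * w p.2)
      (vol01.prod vol01) := by
    have hm : AEStronglyMeasurable (fun p : ℝ × ℝ => fracKer b (x - p.1) * fracKer a (p.1 - p.2) *
        w p.2) (vol01.prod vol01) := hmeas.aestronglyMeasurable.mul hw.1.comp_snd
    rw [integrable_prod_iff' hm]
    constructor
    · exact .of_forall fun s =>
        ((integrable_fracKer_mul_fracKer hb ha s x).integrableOn (s := Ioo 0 1)).mul_const (w s)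
    · refine hw.norm.mono' ?_ ?_
      · refine AEStronglyMeasurable.integral_prod_right' (μ := vol01) (ν := vol01)
          (f := fun p : ℝ × ℝ => ‖fracKer b (x - p.2) * fracKer a (p.2 - p.1) * w p.1‖) ?_
        exact ((by fun_prop : Measurable fun p : ℝ × ℝ => fracKer b (x - p.2) *
          fracKer a (p.2 - p.1)).aestronglyMeasurable.mul hw.1.comp_fst).norm
      · filter_upwards [ae_restrict_mem measurableSet_Ioo] with s hs
        have e : ∀ y, ‖fracKer b (x - y) * fracKer a (y - s) * w s‖ =
            fracKer b (x - y) * fracKer a (y - s) * ‖w s‖ := by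
          intro y
          rw [norm_mul, Real.norm_of_nonneg
            (mul_nonneg (fracKer_nonneg hb _) (fracKer_nonneg ha _))]
        simp only [e]
        rw [integral_mul_const, h0 s hs, norm_mul, norm_norm,
          Real.norm_of_nonneg (fracKer_nonneg one_pos _)]
        exact mul_le_of_le_one_left (norm_nonneg _) (hk _)
  calc leftInt b (leftInt a w) x
      = ∫ y, ∫ s, fracKer b (x - y) * fracKer a (y - s) * w s ∂vol01 ∂vol01 := by
        unfold leftInt
        simp_rw [mul_assoc, integral_const_mul]
    _ = ∫ s, ∫ y, fracKer b (x - y) * fracKer a (y - s) * w s ∂vol01 ∂vol01 :=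
        integral_integral_swap hint
    _ = leftInt 1 w x := by
        refine setIntegral_congr_fun measurableSet_Ioo fun s hs => ?_
        rw [integral_mul_const, h0 s hs]

theorem rightInt_rightInt {a b : ℝ} (ha : 0 < a) (hb : 0 < b) (hab : b + a = 1) {w : ℝ → ℝ}
    (hw : Integrable w vol01) {x : ℝ} (hx : 0 ≤ x) :
    rightInt b (rightInt a w) x = rightInt 1 w x := by
  have h := leftInt_leftInt ha hb hab (measurePreserving_reflect.integrable_comp_of_integrable hw)
    (x := 1 - x) (by linarith)
  rw [rightInt_eq_leftInt_reflect, rightInt_eq_leftInt_reflect 1, ← Function.comp_def w, ← h]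
  congr 1
  ext s
  rw [rightInt_eq_leftInt_reflect, sub_sub_cancel, Function.comp_def]

theorem leftInt_one (w : ℝ → ℝ) {x : ℝ} (hx : x ≤ 1) : leftInt 1 w x = ∫ s in Ioo 0 x, w s := by
  rw [← leftFracInt_eq_leftInt 1 w hx, leftFracInt]
  simp

theorem rightInt_one (w : ℝ → ℝ) {x : ℝ} (hx : 0 ≤ x) : rightInt 1 w x = ∫ s in Ioo x 1, w s := by
  rw [← rightFracInt_eq_rightInt 1 w hx, rightFracInt]
  simp

/-- Over `ℝ`, the product of two integral operators applied to `φ` integrates to the quadratic form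
of the composed kernel. -/
theorem integral_kernel_mul_kernel {K₁ K₂ M : ℝ → ℝ → ℝ}
    (hK₁ : Measurable (Function.uncurry K₁)) (hK₂ : Measurable (Function.uncurry K₂))
    (hK₁0 : ∀ x s, 0 ≤ K₁ x s) (hK₂0 : ∀ x s, 0 ≤ K₂ x s)
    (hM : ∀ᵐ p : ℝ × ℝ ∂(vol01.prod vol01), Integrable (fun x => K₁ x p.1 * K₂ x p.2) ∧
      ∫ x, K₁ x p.1 * K₂ x p.2 = M p.1 p.2)
    (hMi : Integrable (Function.uncurry M) (vol01.prod vol01))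
    {φ : ℝ → ℝ} (hφ : Measurable φ) {C : ℝ} (hC : ∀ x, |φ x| ≤ C) :
    Integrable (fun x => (∫ s, K₁ x s * φ s ∂vol01) * ∫ t, K₂ x t * φ t ∂vol01) ∧
      ∫ x, (∫ s, K₁ x s * φ s ∂vol01) * ∫ t, K₂ x t * φ t ∂vol01 =
        ∫ p, M p.1 p.2 * (φ p.1 * φ p.2) ∂(vol01.prod vol01) := by
  have hm1 : Measurable fun q : ℝ × (ℝ × ℝ) => K₁ q.1 q.2.1 :=
    hK₁.comp (measurable_fst.prodMk (measurable_fst.comp measurable_snd))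
  have hm2 : Measurable fun q : ℝ × (ℝ × ℝ) => K₂ q.1 q.2.2 :=
    hK₂.comp (measurable_fst.prodMk (measurable_snd.comp measurable_snd))
  have hF : Measurable fun q : ℝ × (ℝ × ℝ) =>
      K₁ q.1 q.2.1 * K₂ q.1 q.2.2 * (φ q.2.1 * φ q.2.2) := by fun_prop
  have hint : Integrable (fun q : ℝ × (ℝ × ℝ) =>
      K₁ q.1 q.2.1 * K₂ q.1 q.2.2 * (φ q.2.1 * φ q.2.2))
      (volume.prod (vol01.prod vol01)) := by
    rw [integrable_prod_iff' hF.aestronglyMeasurable]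
    constructor
    · filter_upwards [hM] with p hp
      exact hp.1.mul_const _
    · refine (hMi.mul_const (C * C)).mono' ?_ ?_
      · exact AEStronglyMeasurable.integral_prod_right' (μ := vol01.prod vol01) (ν := volume)
          (f := fun p : (ℝ × ℝ) × ℝ =>
            ‖K₁ p.2 p.1.1 * K₂ p.2 p.1.2 * (φ p.1.1 * φ p.1.2)‖)
          ((hF.comp measurable_swap).norm.aestronglyMeasurable)
      · filter_upwards [hM] with p hp
        have e : ∀ x, ‖K₁ x p.1 * K₂ x p.2 * (φ p.1 * φ p.2)‖ =
            K₁ x p.1 * K₂ x p.2 * (|φ p.1| * |φ p.2|) := by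
          intro x
          rw [norm_mul, Real.norm_of_nonneg (mul_nonneg (hK₁0 _ _) (hK₂0 _ _)), norm_mul,
            Real.norm_eq_abs, Real.norm_eq_abs]
        have h0 : 0 ≤ M p.1 p.2 := by
          rw [← hp.2]
          exact integral_nonneg fun x => mul_nonneg (hK₁0 _ _) (hK₂0 _ _)
        have hC0 : 0 ≤ C := (abs_nonneg _).trans (hC 0)
        simp only [e]
        rw [integral_mul_const, hp.2, Real.norm_of_nonneg (by positivity)]
        exact mul_le_mul_of_nonneg_left
          (mul_le_mul (hC _) (hC _) (abs_nonneg _) hC0) h0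
  have e : ∀ x, (∫ s, K₁ x s * φ s ∂vol01) * ∫ t, K₂ x t * φ t ∂vol01 =
      ∫ p, K₁ x p.1 * K₂ x p.2 * (φ p.1 * φ p.2) ∂(vol01.prod vol01) := by
    intro x
    rw [← integral_prod_mul]
    refine integral_congr_ae (.of_forall fun p => ?_)
    simp only
    ring
  simp_rw [e]
  refine ⟨hint.integral_prod_left, ?_⟩
  rw [integral_integral_swap hint]
  refine integral_congr_ae ?_
  filter_upwards [hM] with p hp
  rw [integral_mul_const, hp.2]

theorem ae_fst_ne_snd : ∀ᵐ p : ℝ × ℝ ∂(vol01.prod vol01), p.1 ≠ p.2 := by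
  rw [ae_iff]
  simp only [not_not]
  rw [Measure.measure_prod_null (measurableSet_eq_fun measurable_fst measurable_snd)]
  refine .of_forall fun x => ?_
  have : Prod.mk x ⁻¹' {a : ℝ × ℝ | a.1 = a.2} = {x} := by
    ext y
    simp [eq_comm]
  simp only [this, Pi.zero_apply]
  exact measure_singleton x

/-- The energy identity on the line: for `φ` supported in `(0,1)`, with `G = I_+^a φ` and
`H = I_-^a φ` one has `(G, H) = cos(πa) ‖G‖² = cos(πa) ‖H‖²`, in `L²(ℝ)`. The left-hand side only
sees `(0,1)`, since `G` vanishes to the left and `H` to the right of it. -/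
theorem integral_leftInt_mul_rightInt {a : ℝ} (ha : 0 < a) (ha' : a < 1 / 2) {φ : ℝ → ℝ}
    (hφ : Measurable φ) {C : ℝ} (hC : ∀ x, |φ x| ≤ C) :
    (Integrable fun x => leftInt a φ x * leftInt a φ x) ∧
    (Integrable fun x => rightInt a φ x * rightInt a φ x) ∧
    Real.cos (Real.pi * a) * (∫ x, leftInt a φ x * leftInt a φ x) =
      ∫ x, leftInt a φ x * rightInt a φ x ∂vol01 ∧
    Real.cos (Real.pi * a) * (∫ x, rightInt a φ x * rightInt a φ x) =
      ∫ x, leftInt a φ x * rightInt a φ x ∂vol01 := by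
  have hc : 0 < Real.cos (Real.pi * a) := cos_pi_mul_pos ha ha'
  have h2a : 0 < 2 * a := by linarith
  have hi1 : Integrable (fun p : ℝ × ℝ => fracKer (2 * a) (p.1 - p.2)) (vol01.prod vol01) := by
    simpa using integrable_fracKer_sub_mul h2a (integrable_const (1 : ℝ))
  have hi2 : Integrable (fun p : ℝ × ℝ => fracKer (2 * a) (p.2 - p.1)) (vol01.prod vol01) :=
    hi1.swap
  have hb : ∀ᵐ p : ℝ × ℝ ∂(vol01.prod vol01), ‖φ p.1 * φ p.2‖ ≤ C * C :=
    .of_forall fun p => by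
      rw [norm_mul]
      exact mul_le_mul (hC _) (hC _) (abs_nonneg _) ((abs_nonneg _).trans (hC 0))
  have hm : Measurable fun p : ℝ × ℝ => φ p.1 * φ p.2 := by fun_prop
  have hj1 := hi1.mul_bdd hm.aestronglyMeasurable hb
  have hj2 := hi2.mul_bdd hm.aestronglyMeasurable hb
  have hsymm : ∫ p : ℝ × ℝ, fracKer (2 * a) (p.1 - p.2) * (φ p.1 * φ p.2) ∂(vol01.prod vol01) =
      ∫ p : ℝ × ℝ, fracKer (2 * a) (p.2 - p.1) * (φ p.1 * φ p.2) ∂(vol01.prod vol01) := by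
    rw [← integral_prod_swap]
    refine integral_congr_ae (.of_forall fun p => ?_)
    simp only [Prod.fst_swap, Prod.snd_swap]
    ring
  have hMi : Integrable (Function.uncurry fun s t : ℝ =>
      (fracKer (2 * a) (t - s) + fracKer (2 * a) (s - t)) / (2 * Real.cos (Real.pi * a)))
      (vol01.prod vol01) := (hi2.add hi1).div_const _
  have hne : ∀ {s t : ℝ}, s ≠ t →
      (fracKer (2 * a) (t - s) + fracKer (2 * a) (s - t)) / (2 * Real.cos (Real.pi * a)) ≠ 0 := by
    intro s t hst
    have hG := Real.Gamma_pos_of_pos h2a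
    have : 0 < fracKer (2 * a) (t - s) + fracKer (2 * a) (s - t) := by
      rcases lt_or_gt_of_ne hst with h | h
      · refine add_pos_of_pos_of_nonneg ?_ (fracKer_nonneg h2a _)
        have : 0 < t - s := sub_pos.2 h
        rw [fracKer_of_pos this]
        positivity
      · refine add_pos_of_nonneg_of_pos (fracKer_nonneg h2a _) ?_
        have : 0 < s - t := sub_pos.2 h
        rw [fracKer_of_pos this]
        positivity
    positivity
  have hval : ∫ p : ℝ × ℝ, (fracKer (2 * a) (p.2 - p.1) + fracKer (2 * a) (p.1 - p.2)) /
      (2 * Real.cos (Real.pi * a)) * (φ p.1 * φ p.2) ∂(vol01.prod vol01) =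
      (∫ p : ℝ × ℝ, fracKer (2 * a) (p.2 - p.1) * (φ p.1 * φ p.2) ∂(vol01.prod vol01)) /
        Real.cos (Real.pi * a) := by
    have e : ∀ p : ℝ × ℝ, (fracKer (2 * a) (p.2 - p.1) + fracKer (2 * a) (p.1 - p.2)) /
      (2 * Real.cos (Real.pi * a)) * (φ p.1 * φ p.2) =
      (2 * Real.cos (Real.pi * a))⁻¹ * (fracKer (2 * a) (p.2 - p.1) * (φ p.1 * φ p.2) +
        fracKer (2 * a) (p.1 - p.2) * (φ p.1 * φ p.2)) := fun p => by ring
    simp_rw [e]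
    rw [integral_const_mul, integral_add hj2 hj1, hsymm]
    field_simp
    ring
  have hGG := integral_kernel_mul_kernel (K₁ := fun x s => fracKer a (x - s))
    (K₂ := fun x s => fracKer a (x - s)) (M := fun s t =>
      (fracKer (2 * a) (t - s) + fracKer (2 * a) (s - t)) / (2 * Real.cos (Real.pi * a)))
    (by simp only [Function.uncurry_def]; fun_prop)
    (by simp only [Function.uncurry_def]; fun_prop)
    (fun x s => fracKer_nonneg ha _) (fun x s => fracKer_nonneg ha _)
    (by
      filter_upwards [ae_fst_ne_snd] with p hp
      have := integral_fracKer_sub_mul_fracKer_sub ha ha' hp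
      exact ⟨.of_integral_ne_zero (this ▸ hne hp), this⟩)
    hMi hφ hC
  have hHH := integral_kernel_mul_kernel (K₁ := fun x s => fracKer a (s - x))
    (K₂ := fun x s => fracKer a (s - x)) (M := fun s t =>
      (fracKer (2 * a) (t - s) + fracKer (2 * a) (s - t)) / (2 * Real.cos (Real.pi * a)))
    (by simp only [Function.uncurry_def]; fun_prop)
    (by simp only [Function.uncurry_def]; fun_prop)
    (fun x s => fracKer_nonneg ha _) (fun x s => fracKer_nonneg ha _)
    (by
      filter_upwards [ae_fst_ne_snd] with p hp
      have := integral_fracKer_sub_mul_fracKer_sub' ha ha' hp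
      exact ⟨.of_integral_ne_zero (this ▸ hne hp), this⟩)
    hMi hφ hC
  have hGH := integral_kernel_mul_kernel (K₁ := fun x s => fracKer a (x - s))
    (K₂ := fun x s => fracKer a (s - x)) (M := fun s t => fracKer (2 * a) (t - s))
    (by simp only [Function.uncurry_def]; fun_prop)
    (by simp only [Function.uncurry_def]; fun_prop)
    (fun x s => fracKer_nonneg ha _) (fun x s => fracKer_nonneg ha _)
    (.of_forall fun p => by
      have h := integral_fracKer_mul_fracKer ha ha p.1 p.2
      have h' := integrable_fracKer_mul_fracKer ha ha p.1 p.2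
      rw [← two_mul] at h
      simp_rw [mul_comm (fracKer a (p.2 - _))] at h h'
      exact ⟨h', h⟩)
    hi2 hφ hC
  have hG1 := hGG.2.trans hval
  have hH1 := hHH.2.trans hval
  have hD := hGH.2
  change ∫ x, leftInt a φ x * rightInt a φ x = _ at hD
  rw [← hD, ← integral_vol01_eq (f := fun x => leftInt a φ x * rightInt a φ x)] at hG1 hH1
  · refine ⟨hGG.1, hHH.1, ?_, ?_⟩
    · exact (congrArg _ hG1).trans (mul_div_cancel₀ _ hc.ne')
    · exact (congrArg _ hH1).trans (mul_div_cancel₀ _ hc.ne')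
  all_goals
    intro x hx
    by_cases h0 : 0 < x
    · rw [rightInt_of_one_le, mul_zero]
      by_contra h
      exact hx ⟨h0, not_le.1 h⟩
    · rw [leftInt_of_nonpos _ (not_lt.1 h0), zero_mul]

/-! ### Test functions -/

theorem IsTest.eq_zero_of_notMem {ψ : ℝ → ℝ} (hψ : IsTest ψ) {x : ℝ} (hx : x ∉ Ioo (0 : ℝ) 1) :
    ψ x = 0 :=
  image_eq_zero_of_notMem_tsupport fun h => hx (hψ.2.2 h)

theorem IsTest.exists_bound {ψ : ℝ → ℝ} (hψ : IsTest ψ) : ∃ C, ∀ x, |ψ x| ≤ C :=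
  hψ.2.1.exists_bound_of_continuous hψ.1.continuous

theorem IsTest.deriv {ψ : ℝ → ℝ} (hψ : IsTest ψ) : IsTest (deriv ψ) :=
  ⟨(contDiff_infty_iff_deriv.1 hψ.1).2, hψ.2.1.deriv,
    tsupport_deriv_subset.trans hψ.2.2⟩

theorem IsTest.neg {ψ : ℝ → ℝ} (hψ : IsTest ψ) : IsTest fun x => -ψ x := by
  refine ⟨hψ.1.neg, hψ.2.1.neg, ?_⟩
  have : tsupport (fun x => -ψ x) = tsupport ψ := by
    simp [tsupport, Function.support_fun_neg]
  rw [this]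
  exact hψ.2.2

theorem IsTest.sub_const_mul {ψ η : ℝ → ℝ} (hψ : IsTest ψ) (hη : IsTest η) (c : ℝ) :
    IsTest fun x => ψ x - c * η x := by
  have hsub : tsupport (fun x => ψ x - c * η x) ⊆ tsupport ψ ∪ tsupport η := by
    refine closure_minimal (fun x hx => ?_) ((isClosed_tsupport _).union (isClosed_tsupport _))
    by_contra h
    rw [mem_union, not_or] at h
    exact hx (by simp [image_eq_zero_of_notMem_tsupport h.1, image_eq_zero_of_notMem_tsupport h.2])
  exact ⟨hψ.1.sub (contDiff_const.mul hη.1),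
    (hψ.2.1.union hη.2.1).of_isClosed_subset (isClosed_tsupport _) hsub,
    hsub.trans (union_subset hψ.2.2 hη.2.2)⟩

/-- The primitive of a test function of mean zero is a test function. -/
theorem IsTest.exists_primitive {φ : ℝ → ℝ} (hφ : IsTest φ) (h0 : ∫ x, φ x ∂vol01 = 0) :
    ∃ ψ, IsTest ψ ∧ _root_.deriv ψ = φ := by
  have hK : IsCompact (insert (1 / 2 : ℝ) (tsupport φ)) :=
    IsCompact.insert hφ.2.1 _
  have hKsub : insert (1 / 2 : ℝ) (tsupport φ) ⊆ Ioo 0 1 :=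
    insert_subset (by norm_num) hφ.2.2
  obtain ⟨a, ha, hal⟩ := hK.exists_isLeast (insert_nonempty _ _)
  obtain ⟨b, hb, hbg⟩ := hK.exists_isGreatest (insert_nonempty _ _)
  have hφa : ∀ x, x < a → φ x = 0 := fun x hx => image_eq_zero_of_notMem_tsupport fun h =>
    hx.not_ge (hal (mem_insert_of_mem _ h))
  have hφb : ∀ x, b < x → φ x = 0 := fun x hx => image_eq_zero_of_notMem_tsupport fun h =>
    hx.not_ge (hbg (mem_insert_of_mem _ h))
  have hc : Continuous φ := hφ.1.continuous
  have hd : ∀ x, HasDerivAt (fun x => ∫ s in (0 : ℝ)..x, φ s) (φ x) x := fun x =>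
    intervalIntegral.integral_hasDerivAt_right (hc.intervalIntegrable _ _)
      hc.aestronglyMeasurable.stronglyMeasurableAtFilter hc.continuousAt
  have hderiv : _root_.deriv (fun x => ∫ s in (0 : ℝ)..x, φ s) = φ := funext fun x => (hd x).deriv
  have hsupp : tsupport (fun x => ∫ s in (0 : ℝ)..x, φ s) ⊆ Icc a b := by
    refine closure_minimal (fun x hx => ?_) isClosed_Icc
    by_contra h
    refine hx ?_
    rcases lt_or_ge x a with h1 | h1
    · refine intervalIntegral.integral_zero_ae (.of_forall fun s hs => hφa s ?_)
      rw [uIoc, mem_Ioc] at hs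
      exact hs.2.trans_lt (max_lt (hKsub ha).1 h1)
    · have h2 : b < x := not_le.1 fun h2 => h ⟨h1, h2⟩
      change ∫ s in (0 : ℝ)..x, φ s = 0
      rw [← intervalIntegral.integral_add_adjacent_intervals (hc.intervalIntegrable 0 1)
        (hc.intervalIntegrable 1 x), intervalIntegral.integral_of_le zero_le_one,
        integral_Ioc_eq_integral_Ioo, h0, zero_add]
      refine intervalIntegral.integral_zero_ae (.of_forall fun s hs => hφb s ?_)
      rw [uIoc, mem_Ioc] at hs
      exact (lt_min (hKsub hb).2 h2).trans hs.1
  refine ⟨_, ⟨?_, isCompact_Icc.of_isClosed_subset (isClosed_tsupport _) hsupp,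
    hsupp.trans (Icc_subset_Ioo (hKsub ha).1 (hKsub hb).2)⟩, hderiv⟩
  rw [contDiff_infty_iff_deriv, hderiv]
  exact ⟨fun x => (hd x).differentiableAt, hφ.1⟩

theorem exists_isTest_integral_eq_one : ∃ η, IsTest η ∧ ∫ x, η x ∂vol01 = 1 := by
  let f : ContDiffBump (1 / 2 : ℝ) := ⟨1 / 8, 1 / 4, by norm_num, by norm_num⟩
  have hs : tsupport (f.normed volume) ⊆ Ioo 0 1 := by
    rw [f.tsupport_normed_eq, Real.closedBall_eq_Icc]
    refine Icc_subset_Ioo ?_ ?_ <;> norm_num [f]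
  have hη : IsTest (f.normed volume) := ⟨f.contDiff_normed, f.hasCompactSupport_normed, hs⟩
  refine ⟨_, hη, ?_⟩
  rw [setIntegral_eq_integral_of_forall_compl_eq_zero fun x hx => hη.eq_zero_of_notMem hx,
    f.integral_normed]

theorem ae_eq_zero_of_integral_mul_test {v : ℝ → ℝ} (hv : Integrable v vol01)
    (h : ∀ ψ, IsTest ψ → ∫ x, v x * ψ x ∂vol01 = 0) : v =ᵐ[vol01] 0 := by
  refine (ae_restrict_iff' measurableSet_Ioo).2 ?_
  refine isOpen_Ioo.ae_eq_zero_of_integral_contDiff_smul_eq_zero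
    (IntegrableOn.locallyIntegrableOn hv) fun ψ h1 h2 h3 => ?_
  have hψ : IsTest ψ := ⟨h1, h2, h3⟩
  rw [← h ψ hψ, setIntegral_eq_integral_of_forall_compl_eq_zero]
  · simp_rw [smul_eq_mul, mul_comm]
  · intro x hx
    rw [hψ.eq_zero_of_notMem hx, mul_zero]

theorem IsTest.integrable_mul {ψ v : ℝ → ℝ} (hψ : IsTest ψ) (hv : Integrable v vol01) :
    Integrable (fun x => v x * ψ x) vol01 := by
  obtain ⟨C, hC⟩ := hψ.exists_bound
  exact hv.mul_bdd hψ.1.continuous.aestronglyMeasurable (.of_forall hC)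

/-- The lemma of du Bois-Reymond: a function with vanishing weak derivative is constant. -/
theorem ae_eq_const_of_integral_mul_deriv_test {v : ℝ → ℝ} (hv : Integrable v vol01)
    (h : ∀ ψ, IsTest ψ → ∫ x, v x * deriv ψ x ∂vol01 = 0) :
    ∃ c : ℝ, v =ᵐ[vol01] fun _ => c := by
  obtain ⟨η, hη, hη1⟩ := exists_isTest_integral_eq_one
  have hone : Integrable (fun _ : ℝ => (1 : ℝ)) vol01 := integrable_const 1
  refine ⟨∫ x, v x * η x ∂vol01, ?_⟩
  set c := ∫ x, v x * η x ∂vol01 with hc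
  have hvc : Integrable (fun x => v x - c) vol01 := hv.sub (integrable_const c)
  have h0 := ae_eq_zero_of_integral_mul_test hvc fun φ hφ => ?_
  · filter_upwards [h0] with x hx
    exact sub_eq_zero.1 hx
  have hφi : Integrable φ vol01 := by simpa using hφ.integrable_mul hone
  have hηi : Integrable η vol01 := by simpa using hη.integrable_mul hone
  set m := ∫ x, φ x ∂vol01 with hm
  obtain ⟨ψ, hψ, hψd⟩ := (hφ.sub_const_mul hη m).exists_primitive (by
    rw [integral_sub hφi (hηi.const_mul m), integral_const_mul, hη1, ← hm]
    ring)
  have h1 := h ψ hψ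
  have e1 : ∀ x, v x * deriv ψ x = v x * φ x - m * (v x * η x) := fun x => by
    rw [hψd]; ring
  have e2 : ∀ x, (v x - c) * φ x = v x * φ x - c * φ x := fun x => by ring
  simp_rw [e1] at h1
  rw [integral_sub (hφ.integrable_mul hv) ((hη.integrable_mul hv).const_mul m),
    integral_const_mul, ← hc] at h1
  simp_rw [e2]
  rw [integral_sub (hφ.integrable_mul hv) (hφi.const_mul c), integral_const_mul, ← hm]
  linarith

/-! ### Fractional integrals of square-integrable functions -/

theorem integrable_of_memLp_two {g : ℝ → ℝ} (hg : MemLp g 2 vol01) : Integrable g vol01 :=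
  hg.integrable (by norm_num)

theorem inner_eq_integral (f g : Lp ℝ 2 vol01) : inner ℝ f g = ∫ x, f x * g x ∂vol01 := by
  rw [L2.inner_def]
  refine integral_congr_ae (.of_forall fun x => ?_)
  simp [mul_comm]

theorem inner_toLp_eq_integral {k : ℝ → ℝ} (hk : MemLp k 2 vol01) (g : Lp ℝ 2 vol01) :
    inner ℝ (hk.toLp k) g = ∫ x, k x * g x ∂vol01 := by
  rw [inner_eq_integral]
  refine integral_congr_ae ?_
  filter_upwards [hk.coeFn_toLp] with x hx
  rw [hx]

theorem fracKer_sq {b : ℝ} (hb : 1 / 2 < b) (y : ℝ) : fracKer b y ^ 2 =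
    Real.Gamma (2 * b - 1) / Real.Gamma b ^ 2 * fracKer (2 * b - 1) y := by
  rcases le_or_gt y 0 with hy | hy
  · simp [fracKer_of_nonpos hy]
  · have h1 := Real.Gamma_pos_of_pos (s := 2 * b - 1) (by linarith)
    rw [fracKer_of_pos hy, fracKer_of_pos hy, div_pow, ← Real.rpow_natCast, ← Real.rpow_mul hy.le]
    rw [show (b - 1) * ((2 : ℕ) : ℝ) = 2 * b - 1 - 1 by push_cast; ring]
    generalize Real.Gamma (2 * b - 1) = G at h1 ⊢
    field_simp

/-- For `b > 1/2` the value of `I_+^b g` at a point is the pairing of `g` with the kernel, which is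
square-integrable. -/
theorem exists_inner_eq_leftInt {b : ℝ} (hb : 1 / 2 < b) {x : ℝ} (hx : x ≤ 1) :
    ∃ k : Lp ℝ 2 vol01, ‖k‖ ^ 2 = Real.Gamma (2 * b - 1) / Real.Gamma b ^ 2 * fracKer (2 * b) x ∧
      ∀ g : Lp ℝ 2 vol01, leftInt b g x = inner ℝ k g := by
  have hi := integral_fracKer_sub_left (α := 2 * b - 1) (by linarith) hx
  rw [sub_add_cancel] at hi
  have hk : MemLp (fun s => fracKer b (x - s)) 2 vol01 := by
    rw [memLp_two_iff_integrable_sq (Measurable.aestronglyMeasurable (by fun_prop))]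
    simp_rw [fracKer_sq hb]
    exact hi.1.const_mul _
  refine ⟨hk.toLp _, ?_, fun g => (inner_toLp_eq_integral hk g).symm⟩
  rw [← real_inner_self_eq_norm_sq, inner_toLp_eq_integral, ← hi.2, ← integral_const_mul]
  refine integral_congr_ae ?_
  filter_upwards [hk.coeFn_toLp] with s hs
  rw [hs, ← fracKer_sq hb, sq]

theorem IsTest.eq_rightInt_one {ψ : ℝ → ℝ} (hψ : IsTest ψ) {x : ℝ} (hx : x ∈ Ioo (0 : ℝ) 1) :
    ψ x = rightInt 1 (fun s => -_root_.deriv ψ s) x := by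
  rw [rightInt_one _ hx.1.le, integral_neg, ← integral_Ioc_eq_integral_Ioo,
    ← intervalIntegral.integral_of_le hx.2.le, intervalIntegral.integral_deriv_eq_sub' ψ rfl
    (fun y _ => (hψ.1.differentiable (by simp)).differentiableAt)
    (continuous_deriv_test hψ).continuousOn, hψ.eq_zero_of_notMem (x := 1) (by simp)]
  ring

theorem ae_eq_zero_of_leftInt_one {g : ℝ → ℝ} (hg : Integrable g vol01)
    (h : ∀ x ∈ Ioo (0 : ℝ) 1, leftInt 1 g x = 0) : g =ᵐ[vol01] 0 := by
  refine ae_eq_zero_of_integral_mul_test hg fun ψ hψ => ?_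
  obtain ⟨C, hC⟩ := hψ.deriv.neg.exists_bound
  have h1 := (integral_leftInt_mul one_pos hg hψ.deriv.neg.1.continuous.aestronglyMeasurable hC).2
  have h2 : ∫ x, g x * ψ x ∂vol01 = ∫ x, g x * rightInt 1 (fun s => -deriv ψ s) x ∂vol01 :=
    setIntegral_congr_fun measurableSet_Ioo fun x hx => by
      rw [← hψ.eq_rightInt_one hx]
  rw [h2, ← h1, ← integral_zero ℝ ℝ]
  refine setIntegral_congr_fun measurableSet_Ioo fun x hx => ?_
  simp only [h x hx, zero_mul]

/-- `I_+^{1-a} g` is not a nonzero constant for `g ∈ L²`. Applying `I_+^a` to `I_+^{1-a} g = c`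
gives `∫_0^x g = c x^a / Γ(a+1)`, and the left-hand side is `O(√x)` by Cauchy–Schwarz, which forces
`c = 0` since `a < 1/2`. -/
theorem ae_eq_zero_of_leftInt_ae_eq_const {a : ℝ} (ha : 0 < a) (ha' : a < 1 / 2) {g : ℝ → ℝ}
    (hg : MemLp g 2 vol01) {c : ℝ} (h : leftInt (1 - a) g =ᵐ[vol01] fun _ => c) :
    g =ᵐ[vol01] 0 := by
  have hgi := integrable_of_memLp_two hg
  have h1 : ∀ x ≤ 1, leftInt 1 g x = c * fracKer (a + 1) x := by
    intro x hx
    rw [← leftInt_leftInt (a := 1 - a) (b := a) (by linarith) ha (by ring) hgi hx,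
      leftInt_congr h, leftInt, integral_mul_const, (integral_fracKer_sub_left ha hx).2, mul_comm]
  have hΓ := Real.Gamma_pos_of_pos (s := a + 1) (by linarith)
  set N := ‖hg.toLp g‖ with hN
  have h2 : ∀ x ∈ Ioo (0 : ℝ) 1, c ^ 2 ≤ (N * Real.Gamma (a + 1)) ^ 2 * x ^ (1 - 2 * a) := by
    intro x hx
    obtain ⟨k, hk1, hk2⟩ := exists_inner_eq_leftInt (b := 1) (by norm_num) hx.2.le
    have hk3 : ‖k‖ ^ 2 = x := by
      rw [hk1, fracKer_of_pos hx.1]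
      norm_num
    have h3 : c * fracKer (a + 1) x = inner ℝ k (hg.toLp g) := by
      rw [← hk2, ← h1 x hx.2.le, leftInt_congr hg.coeFn_toLp]
    have h4 : (c * fracKer (a + 1) x) ^ 2 ≤ x * N ^ 2 := by
      rw [h3, ← hk3, ← mul_pow, sq_le_sq, abs_of_nonneg (a := ‖k‖ * N) (by positivity)]
      exact abs_real_inner_le_norm _ _
    rw [fracKer_of_pos hx.1, add_sub_cancel_right, mul_div_assoc', div_pow,
      div_le_iff₀ (by positivity)] at h4
    have h5 : 0 < x ^ a := Real.rpow_pos_of_pos hx.1 _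
    have h6 : x ^ (1 - 2 * a) = x / (x ^ a) ^ 2 := by
      rw [Real.rpow_sub hx.1, Real.rpow_one, mul_comm 2 a, Real.rpow_mul hx.1.le]
      norm_num
    rw [h6, mul_div_assoc', le_div_iff₀ (by positivity)]
    nlinarith
  have hc : c = 0 := by
    have hlim : Filter.Tendsto (fun x : ℝ => (N * Real.Gamma (a + 1)) ^ 2 * x ^ (1 - 2 * a))
        (nhdsWithin 0 (Ioi 0)) (nhds 0) := by
      have h3 : Filter.Tendsto (fun x : ℝ => x ^ (1 - 2 * a)) (nhds 0) (nhds 0) := by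
        have := (Real.continuousAt_rpow_const 0 (1 - 2 * a) (Or.inr (by linarith))).tendsto
        rwa [Real.zero_rpow (by linarith)] at this
      simpa using (h3.mono_left nhdsWithin_le_nhds).const_mul ((N * Real.Gamma (a + 1)) ^ 2)
    have h4 : c ^ 2 ≤ 0 := by
      refine ge_of_tendsto hlim ?_
      filter_upwards [Ioo_mem_nhdsGT one_pos] with x hx using h2 x hx
    exact pow_eq_zero_iff two_ne_zero |>.1 (le_antisymm h4 (sq_nonneg c))
  exact ae_eq_zero_of_leftInt_one hgi fun x hx => by rw [h1 x hx.2.le, hc, zero_mul]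

theorem ae_eq_zero_of_rightInt_ae_eq_const {a : ℝ} (ha : 0 < a) (ha' : a < 1 / 2) {h : ℝ → ℝ}
    (hh : MemLp h 2 vol01) {c : ℝ} (hc : rightInt (1 - a) h =ᵐ[vol01] fun _ => c) :
    h =ᵐ[vol01] 0 := by
  have h1 : leftInt (1 - a) (h ∘ fun x => 1 - x) =ᵐ[vol01] fun _ => c := by
    filter_upwards [measurePreserving_reflect.quasiMeasurePreserving.ae hc] with x hx
    rwa [rightInt_eq_leftInt_reflect, sub_sub_cancel] at hx
  have h2 := ae_eq_zero_of_leftInt_ae_eq_const ha ha'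
    (hh.comp_measurePreserving measurePreserving_reflect) h1
  filter_upwards [measurePreserving_reflect.quasiMeasurePreserving.ae h2] with x hx
  simpa using hx

/-! ### The weak Caputo derivatives -/

theorem rightCaputo_eq_rightInt (α : ℝ) (ψ : ℝ → ℝ) {x : ℝ} (hx : x ∈ Ioo (0 : ℝ) 1) :
    rightCaputo α ψ x = rightInt α (fun s => -deriv ψ s) x :=
  rightFracInt_eq_rightInt α _ hx.1.le

theorem leftCaputo_eq_leftInt (α : ℝ) (ψ : ℝ → ℝ) {x : ℝ} (hx : x ∈ Ioo (0 : ℝ) 1) :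
    leftCaputo α ψ x = leftInt α (deriv ψ) x :=
  leftFracInt_eq_leftInt α _ hx.2.le

theorem integral_mul_rightCaputo {α : ℝ} (hα : 0 < α) {g ψ : ℝ → ℝ} (hg : Integrable g vol01)
    (hψ : IsTest ψ) : Integrable (fun x => g x * rightCaputo α ψ x) vol01 ∧
      ∫ x, g x * rightCaputo α ψ x ∂vol01 = -∫ x, leftInt α g x * deriv ψ x ∂vol01 := by
  obtain ⟨C, hC⟩ := hψ.deriv.neg.exists_bound
  have h := integral_leftInt_mul hα hg hψ.deriv.neg.1.continuous.aestronglyMeasurable hC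
  constructor
  · refine IntegrableOn.congr_fun h.1 (fun x hx => ?_) measurableSet_Ioo
    simp only [rightCaputo_eq_rightInt α ψ hx]
  · have e : ∫ x, g x * rightCaputo α ψ x ∂vol01 =
        ∫ x, g x * rightInt α (fun s => -deriv ψ s) x ∂vol01 :=
      setIntegral_congr_fun measurableSet_Ioo fun x hx => by
        simp only [rightCaputo_eq_rightInt α ψ hx]
    rw [e, ← h.2, ← integral_neg]
    simp_rw [mul_neg]

theorem integral_mul_leftCaputo {α : ℝ} (hα : 0 < α) {g ψ : ℝ → ℝ} (hg : Integrable g vol01)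
    (hψ : IsTest ψ) : Integrable (fun x => g x * leftCaputo α ψ x) vol01 ∧
      ∫ x, g x * leftCaputo α ψ x ∂vol01 = ∫ x, rightInt α g x * deriv ψ x ∂vol01 := by
  obtain ⟨C, hC⟩ := hψ.deriv.exists_bound
  have h := integral_rightInt_mul hα hg hψ.deriv.1.continuous.aestronglyMeasurable hC
  constructor
  · refine IntegrableOn.congr_fun h.1 (fun x hx => ?_) measurableSet_Ioo
    simp only [leftCaputo_eq_leftInt α ψ hx]
  · rw [h.2]
    exact setIntegral_congr_fun measurableSet_Ioo fun x hx => by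
      simp only [leftCaputo_eq_leftInt α ψ hx]

theorem exists_ae_eq_add_const_iff {v w : ℝ → ℝ} (hv : Integrable v vol01)
    (hw : Integrable w vol01) : (∃ c : ℝ, v =ᵐ[vol01] fun x => w x + c) ↔
      ∀ ψ, IsTest ψ → ∫ x, v x * deriv ψ x ∂vol01 = ∫ x, w x * deriv ψ x ∂vol01 := by
  constructor
  · rintro ⟨c, hc⟩ ψ hψ
    have hd : Integrable (deriv ψ) vol01 := by
      simpa using hψ.deriv.integrable_mul (integrable_const (1 : ℝ))
    have e : (fun x => v x * deriv ψ x) =ᵐ[vol01] fun x => w x * deriv ψ x + c * deriv ψ x := by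
      filter_upwards [hc] with x hx
      rw [hx, add_mul]
    rw [integral_congr_ae e, integral_add (hψ.deriv.integrable_mul hw) (hd.const_mul c),
      integral_const_mul, integral_deriv_test hψ, mul_zero, add_zero]
  · intro h
    obtain ⟨c, hc⟩ := ae_eq_const_of_integral_mul_deriv_test (hv.sub hw) fun ψ hψ => by
      simp_rw [Pi.sub_apply, sub_mul]
      rw [integral_sub (hψ.deriv.integrable_mul hv) (hψ.deriv.integrable_mul hw), h ψ hψ, sub_self]
    refine ⟨c, ?_⟩
    filter_upwards [hc] with x hx
    rw [← hx, Pi.sub_apply]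
    ring

theorem isWeakLeftCaputo_iff {a : ℝ} (ha : a < 1) {v g : ℝ → ℝ} (hv : Integrable v vol01)
    (hg : Integrable g vol01) :
    IsWeakLeftCaputo a v g ↔ ∃ c : ℝ, v =ᵐ[vol01] fun x => leftInt (1 - a) g x + c := by
  have ha' : 0 < 1 - a := by linarith
  rw [exists_ae_eq_add_const_iff hv (integrable_leftInt ha' hg)]
  refine forall₂_congr fun ψ hψ => ?_
  have h := integral_mul_rightCaputo ha' hg hψ
  rw [h.2, and_iff_right h.1, neg_inj, eq_comm]

theorem isWeakRightCaputo_iff {a : ℝ} (ha : a < 1) {v h : ℝ → ℝ} (hv : Integrable v vol01)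
    (hh : Integrable h vol01) :
    IsWeakRightCaputo a v h ↔ ∃ c : ℝ, v =ᵐ[vol01] fun x => rightInt (1 - a) h x + c := by
  have ha' : 0 < 1 - a := by linarith
  rw [exists_ae_eq_add_const_iff hv (integrable_rightInt ha' hh)]
  refine forall₂_congr fun ψ hψ => ?_
  have h := integral_mul_leftCaputo ha' hh hψ
  rw [h.2, and_iff_right h.1, eq_comm]

/-! ### The pair of Caputo derivatives of a primitive -/

theorem IsTest.add {ψ η : ℝ → ℝ} (hψ : IsTest ψ) (hη : IsTest η) :
    IsTest fun x => ψ x + η x := by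
  simpa using hψ.sub_const_mul hη (-1)

theorem isTest_zero : IsTest fun _ => (0 : ℝ) := by
  refine ⟨contDiff_const, HasCompactSupport.zero, ?_⟩
  simp [tsupport]

theorem IsTest.const_mul {ψ : ℝ → ℝ} (hψ : IsTest ψ) (c : ℝ) : IsTest fun x => c * ψ x := by
  simpa using isTest_zero.sub_const_mul hψ (-c)

theorem IsTest.integrable {ψ : ℝ → ℝ} (hψ : IsTest ψ) : Integrable ψ vol01 := by
  simpa using hψ.integrable_mul (integrable_const (1 : ℝ))

theorem leftInt_add_test {a : ℝ} (ha : 0 < a) {φ η : ℝ → ℝ} (hφ : IsTest φ) (hη : IsTest η)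
    {x : ℝ} (hx : x ≤ 1) :
    leftInt a (fun s => φ s + η s) x = leftInt a φ x + leftInt a η x := by
  obtain ⟨C, hC⟩ := hφ.exists_bound
  obtain ⟨D, hD⟩ := hη.exists_bound
  have hk := (integral_fracKer_sub_left ha hx).1
  simp_rw [leftInt, mul_add]
  exact integral_add (hk.mul_bdd hφ.1.continuous.aestronglyMeasurable (.of_forall hC))
    (hk.mul_bdd hη.1.continuous.aestronglyMeasurable (.of_forall hD))

theorem leftInt_const_mul (a c : ℝ) (φ : ℝ → ℝ) (x : ℝ) :
    leftInt a (fun s => c * φ s) x = c * leftInt a φ x := by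
  simp_rw [leftInt, ← integral_const_mul, mul_left_comm]

theorem IsTest.reflect {φ : ℝ → ℝ} (hφ : IsTest φ) : IsTest fun x => φ (1 - x) := by
  have hsub : tsupport (fun x => φ (1 - x)) ⊆ (fun x => 1 - x) ⁻¹' tsupport φ :=
    closure_minimal (fun x hx => subset_tsupport _ hx)
      ((isClosed_tsupport φ).preimage (by fun_prop))
  refine ⟨hφ.1.comp (contDiff_const.sub contDiff_id),
    hφ.2.1.comp_homeomorph (Homeomorph.subLeft (1 : ℝ)), fun x hx => ?_⟩
  have := hφ.2.2 (hsub hx)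
  exact ⟨by linarith [this.2], by linarith [this.1]⟩

theorem rightInt_add_test {a : ℝ} (ha : 0 < a) {φ η : ℝ → ℝ} (hφ : IsTest φ) (hη : IsTest η)
    {x : ℝ} (hx : 0 ≤ x) :
    rightInt a (fun s => φ s + η s) x = rightInt a φ x + rightInt a η x := by
  simp_rw [rightInt_eq_leftInt_reflect]
  exact leftInt_add_test ha hφ.reflect hη.reflect (by linarith)

theorem rightInt_const_mul (a c : ℝ) (φ : ℝ → ℝ) (x : ℝ) :
    rightInt a (fun s => c * φ s) x = c * rightInt a φ x := by
  simp_rw [rightInt, ← integral_const_mul, mul_left_comm]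

/-- The pairs `(I_+^a φ, -I_-^a φ)` with `φ ∈ C_0^∞(0,1)`: the left and the right Caputo derivative
of order `1 - a` of the primitives of `φ`. -/
def testPairs {a : ℝ} (ha : 0 < a) : Submodule ℝ (Lp ℝ 2 vol01 × Lp ℝ 2 vol01) where
  carrier := {p | ∃ φ, IsTest φ ∧ p.1 =ᵐ[vol01] leftInt a φ ∧
    p.2 =ᵐ[vol01] fun x => -rightInt a φ x}
  zero_mem' := by
    refine ⟨_, isTest_zero, ?_, ?_⟩
    · filter_upwards [Lp.coeFn_zero ℝ 2 vol01] with x hx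
      rw [Prod.fst_zero, hx]
      simp [leftInt]
    · filter_upwards [Lp.coeFn_zero ℝ 2 vol01] with x hx
      rw [Prod.snd_zero, hx]
      simp [rightInt]
  add_mem' := by
    rintro p q ⟨φ, hφ, h1, h2⟩ ⟨η, hη, h3, h4⟩
    refine ⟨_, hφ.add hη, ?_, ?_⟩
    · filter_upwards [Lp.coeFn_add p.1 q.1, h1, h3, ae_restrict_mem measurableSet_Ioo]
        with x hx hx1 hx2 hx3
      rw [Prod.fst_add, hx, Pi.add_apply, hx1, hx2, leftInt_add_test ha hφ hη hx3.2.le]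
    · filter_upwards [Lp.coeFn_add p.2 q.2, h2, h4, ae_restrict_mem measurableSet_Ioo]
        with x hx hx1 hx2 hx3
      rw [Prod.snd_add, hx, Pi.add_apply, hx1, hx2, rightInt_add_test ha hφ hη hx3.1.le]
      ring
  smul_mem' := by
    rintro c p ⟨φ, hφ, h1, h2⟩
    refine ⟨_, hφ.const_mul c, ?_, ?_⟩
    · filter_upwards [Lp.coeFn_smul c p.1, h1] with x hx hx1
      rw [Prod.smul_fst, hx, Pi.smul_apply, hx1, leftInt_const_mul, smul_eq_mul]
    · filter_upwards [Lp.coeFn_smul c p.2, h2] with x hx hx1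
      rw [Prod.smul_snd, hx, Pi.smul_apply, hx1, rightInt_const_mul, smul_eq_mul]
      ring

theorem memLp_leftInt_test {a : ℝ} (ha : 0 < a) (ha' : a < 1 / 2) {φ : ℝ → ℝ} (hφ : IsTest φ) :
    MemLp (leftInt a φ) 2 vol01 ∧ MemLp (rightInt a φ) 2 vol01 := by
  obtain ⟨C, hC⟩ := hφ.exists_bound
  obtain ⟨h1, h2, -⟩ := integral_leftInt_mul_rightInt ha ha' hφ.1.continuous.measurable hC
  constructor
  · rw [memLp_two_iff_integrable_sq (integrable_leftInt ha hφ.integrable).1]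
    simp_rw [sq]
    exact h1.integrableOn
  · rw [memLp_two_iff_integrable_sq (integrable_rightInt ha hφ.integrable).1]
    simp_rw [sq]
    exact h2.integrableOn

/-- The coercivity estimate, together with the dual one that bounds the right derivative. -/
theorem testPairs_estimate {a : ℝ} (ha : 0 < a) (ha' : a < 1 / 2)
    {p : Lp ℝ 2 vol01 × Lp ℝ 2 vol01} (hp : p ∈ testPairs ha) :
    Real.cos (Real.pi * a) * ‖p.1‖ ^ 2 ≤ -inner ℝ p.1 p.2 ∧
      Real.cos (Real.pi * a) * ‖p.2‖ ^ 2 ≤ -inner ℝ p.1 p.2 := by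
  obtain ⟨φ, hφ, h1, h2⟩ := hp
  obtain ⟨C, hC⟩ := hφ.exists_bound
  obtain ⟨i1, i2, e1, e2⟩ :=
    integral_leftInt_mul_rightInt ha ha' hφ.1.continuous.measurable hC
  have hc : 0 < Real.cos (Real.pi * a) := cos_pi_mul_pos ha ha'
  have hi : -inner ℝ p.1 p.2 = ∫ x, leftInt a φ x * rightInt a φ x ∂vol01 := by
    rw [inner_eq_integral, ← integral_neg]
    refine integral_congr_ae ?_
    filter_upwards [h1, h2] with x hx1 hx2
    rw [hx1, hx2]
    ring
  constructor
  · rw [hi, ← e1, ← real_inner_self_eq_norm_sq, inner_eq_integral]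
    refine mul_le_mul_of_nonneg_left ?_ hc.le
    refine le_trans (le_of_eq (integral_congr_ae ?_))
      (setIntegral_le_integral i1 (.of_forall fun x => mul_self_nonneg (leftInt a φ x)))
    filter_upwards [h1] with x hx
    rw [hx]
  · rw [hi, ← e2, ← real_inner_self_eq_norm_sq, inner_eq_integral]
    refine mul_le_mul_of_nonneg_left ?_ hc.le
    refine le_trans (le_of_eq (integral_congr_ae ?_))
      (setIntegral_le_integral i2 (.of_forall fun x => mul_self_nonneg (rightInt a φ x)))
    filter_upwards [h2] with x hx
    rw [hx, neg_mul_neg]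

theorem testPairs_integral_caputo {a : ℝ} (ha : 0 < a) (ha' : a < 1 / 2)
    {p : Lp ℝ 2 vol01 × Lp ℝ 2 vol01} (hp : p ∈ testPairs ha) {ψ : ℝ → ℝ} (hψ : IsTest ψ) :
    ∫ x, p.2 x * leftCaputo (1 - a) ψ x ∂vol01 =
      -∫ x, p.1 x * rightCaputo (1 - a) ψ x ∂vol01 := by
  obtain ⟨φ, hφ, h1, h2⟩ := hp
  have hb : 0 < 1 - a := by linarith
  have hp1 := integrable_of_memLp_two (Lp.memLp p.1)
  have hp2 := integrable_of_memLp_two (Lp.memLp p.2)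
  rw [(integral_mul_leftCaputo hb hp2 hψ).2, (integral_mul_rightCaputo hb hp1 hψ).2, neg_neg]
  refine (exists_ae_eq_add_const_iff (integrable_rightInt hb hp2)
    (integrable_leftInt hb hp1)).1 ⟨-∫ s, φ s ∂vol01, ?_⟩ ψ hψ
  refine (ae_restrict_iff' measurableSet_Ioo).2 (.of_forall fun x hx => ?_)
  have e1 : leftInt (1 - a) p.1 x = ∫ s in (0 : ℝ)..x, φ s := by
    rw [leftInt_congr h1, leftInt_leftInt ha hb (by ring) hφ.integrable hx.2.le,
      leftInt_one _ hx.2.le, intervalIntegral.integral_of_le hx.1.le, integral_Ioc_eq_integral_Ioo]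
  have e2 : rightInt (1 - a) p.2 x = -∫ s in x..1, φ s := by
    have e3 : (fun x => -rightInt a φ x) = fun x => (-1) * rightInt a φ x := by
      ext; ring
    rw [rightInt_congr h2, e3, rightInt_const_mul, rightInt_rightInt ha hb (by ring)
      hφ.integrable hx.1.le, rightInt_one _ hx.1.le, intervalIntegral.integral_of_le hx.2.le,
      integral_Ioc_eq_integral_Ioo]
    ring
  have hc := hφ.1.continuous
  beta_reduce
  rw [e1, e2, ← integral_Ioc_eq_integral_Ioo, ← intervalIntegral.integral_of_le zero_le_one,
    ← intervalIntegral.integral_add_adjacent_intervals (hc.intervalIntegrable 0 x)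
    (hc.intervalIntegrable x 1)]
  ring

/-- The functions `I_+^a φ` are dense in `L²`: what is orthogonal to all of them is annihilated by
`I_-^a`, hence by `I_-^1 = I_-^{1-a} I_-^a`. -/
theorem dense_fst_testPairs {a : ℝ} (ha : 0 < a) (ha' : a < 1 / 2) :
    ((testPairs ha).map (LinearMap.fst ℝ _ _)).topologicalClosure = ⊤ := by
  rw [Submodule.topologicalClosure_eq_top_iff, Submodule.eq_bot_iff]
  intro g hg
  have hgi := integrable_of_memLp_two (Lp.memLp g)
  have h0 : rightInt a g =ᵐ[vol01] 0 := by
    refine ae_eq_zero_of_integral_mul_test (integrable_rightInt ha hgi) fun φ hφ => ?_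
    obtain ⟨C, hC⟩ := hφ.exists_bound
    obtain ⟨m1, m2⟩ := memLp_leftInt_test ha ha' hφ
    rw [(integral_rightInt_mul ha hgi hφ.1.continuous.aestronglyMeasurable hC).2]
    have := (Submodule.mem_orthogonal _ _).1 hg (m1.toLp _)
      ⟨(m1.toLp _, m2.neg.toLp _), ⟨φ, hφ, m1.coeFn_toLp, m2.neg.coeFn_toLp⟩, rfl⟩
    rw [inner_toLp_eq_integral] at this
    simpa only [mul_comm] using this
  have h1 : ∀ x ∈ Ioo (0 : ℝ) 1, leftInt 1 (g ∘ fun x => 1 - x) x = 0 := by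
    intro x hx
    have h2 := rightInt_rightInt (b := 1 - a) ha (by linarith) (by ring) hgi (x := 1 - x)
      (by linarith [hx.2])
    rw [rightInt_congr h0, rightInt_eq_leftInt_reflect 1, sub_sub_cancel] at h2
    rw [Function.comp_def, ← h2]
    simp [rightInt]
  have h3 := ae_eq_zero_of_leftInt_one
    (measurePreserving_reflect.integrable_comp_of_integrable hgi) h1
  rw [Lp.eq_zero_iff_ae_eq_zero]
  filter_upwards [measurePreserving_reflect.quasiMeasurePreserving.ae h3] with x hx
  simpa using hx

theorem continuous_integral_mul_of_memLp {k : ℝ → ℝ} (hk : MemLp k 2 vol01) :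
    Continuous fun g : Lp ℝ 2 vol01 => ∫ x, g x * k x ∂vol01 := by
  have : (fun g : Lp ℝ 2 vol01 => ∫ x, g x * k x ∂vol01) =
      fun g : Lp ℝ 2 vol01 => inner ℝ (hk.toLp k) g := by
    ext g
    rw [inner_toLp_eq_integral]
    simp_rw [mul_comm]
  rw [this]
  fun_prop

theorem abs_leftInt_le {α : ℝ} (hα : 0 < α) {φ : ℝ → ℝ} {C : ℝ} (hC : ∀ x, |φ x| ≤ C) {x : ℝ}
    (hx : x ≤ 1) : |leftInt α φ x| ≤ C * (1 / Real.Gamma (α + 1)) := by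
  have hk := integral_fracKer_sub_left hα hx
  have hC0 : 0 ≤ C := (abs_nonneg _).trans (hC 0)
  calc |leftInt α φ x| ≤ ∫ s, C * fracKer α (x - s) ∂vol01 := by
        rw [← Real.norm_eq_abs, leftInt]
        refine norm_integral_le_of_norm_le (hk.1.const_mul C) (.of_forall fun s => ?_)
        rw [norm_mul, Real.norm_of_nonneg (fracKer_nonneg hα _), mul_comm]
        exact mul_le_mul_of_nonneg_right (hC s) (fracKer_nonneg hα _)
    _ ≤ C * (1 / Real.Gamma (α + 1)) := by
        rw [integral_const_mul, hk.2]
        exact mul_le_mul_of_nonneg_left (fracKer_add_one_le hα hx) hC0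

theorem memLp_leftCaputo {α : ℝ} (hα : 0 < α) {ψ : ℝ → ℝ} (hψ : IsTest ψ) :
    MemLp (leftCaputo α ψ) 2 vol01 := by
  obtain ⟨C, hC⟩ := hψ.deriv.exists_bound
  have h : MemLp (leftInt α (deriv ψ)) 2 vol01 := by
    refine .of_bound (integrable_leftInt hα hψ.deriv.integrable).1
      (C * (1 / Real.Gamma (α + 1))) ?_
    filter_upwards [ae_restrict_mem measurableSet_Ioo] with x hx
    exact abs_leftInt_le hα hC hx.2.le
  refine h.ae_eq ?_
  filter_upwards [ae_restrict_mem measurableSet_Ioo] with x hx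
  exact (leftCaputo_eq_leftInt α ψ hx).symm

theorem memLp_rightCaputo {α : ℝ} (hα : 0 < α) {ψ : ℝ → ℝ} (hψ : IsTest ψ) :
    MemLp (rightCaputo α ψ) 2 vol01 := by
  obtain ⟨C, hC⟩ := hψ.deriv.neg.exists_bound
  have h : MemLp (rightInt α fun s => -deriv ψ s) 2 vol01 := by
    refine .of_bound (integrable_rightInt hα hψ.deriv.neg.integrable).1
      (C * (1 / Real.Gamma (α + 1))) ?_
    filter_upwards [ae_restrict_mem measurableSet_Ioo] with x hx
    rw [rightInt_eq_leftInt_reflect]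
    exact abs_leftInt_le hα (fun s => hC (1 - s)) (by linarith [hx.1])
  refine h.ae_eq ?_
  filter_upwards [ae_restrict_mem measurableSet_Ioo] with x hx
  exact (rightCaputo_eq_rightInt α ψ hx).symm

theorem norm_snd_le_of_estimate {c : ℝ} {g h : Lp ℝ 2 vol01} (hc : 0 < c)
    (he : c * ‖h‖ ^ 2 ≤ -inner ℝ g h) : ‖h‖ ≤ c⁻¹ * ‖g‖ := by
  have h1 : -inner ℝ g h ≤ ‖g‖ * ‖h‖ := (neg_le_abs _).trans (abs_real_inner_le_norm g h)
  rcases (norm_nonneg h).eq_or_lt with h0 | h0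
  · rw [← h0]; positivity
  · rw [inv_mul_eq_div, le_div_iff₀ hc]
    have : (‖h‖ * c) * ‖h‖ ≤ ‖g‖ * ‖h‖ := by nlinarith
    exact le_of_mul_le_mul_right this h0

/-- Every `g ∈ L²` has a partner `h` such that some `v` has `g` as left and `h` as right Caputo
derivative. The estimates make the projection of the closure of `testPairs` to its first component
bounded below, so that its range is closed; it is also dense. -/
theorem exists_pair {a : ℝ} (ha : 0 < a) (ha' : a < 1 / 2) (g : Lp ℝ 2 vol01) :
    ∃ h : Lp ℝ 2 vol01,
      Real.cos (Real.pi * a) * ‖g‖ ^ 2 ≤ -inner ℝ g h ∧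
      Real.cos (Real.pi * a) * ‖h‖ ^ 2 ≤ -inner ℝ g h ∧
      ∀ ψ, IsTest ψ → ∫ x, h x * leftCaputo (1 - a) ψ x ∂vol01 =
        -∫ x, g x * rightCaputo (1 - a) ψ x ∂vol01 := by
  have hc : 0 < Real.cos (Real.pi * a) := cos_pi_mul_pos ha ha'
  have hb : 0 < 1 - a := by linarith
  set Q := (testPairs ha).topologicalClosure with hQ
  have hQ1 : ∀ p ∈ Q, Real.cos (Real.pi * a) * ‖p.1‖ ^ 2 ≤ -inner ℝ p.1 p.2 ∧
      Real.cos (Real.pi * a) * ‖p.2‖ ^ 2 ≤ -inner ℝ p.1 p.2 := by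
    intro p hp
    refine closure_minimal (fun q hq => testPairs_estimate ha ha' hq) ?_ hp
    have hi : Continuous fun p : Lp ℝ 2 vol01 × Lp ℝ 2 vol01 => -inner ℝ p.1 p.2 := by fun_prop
    exact (isClosed_le (by fun_prop : Continuous fun p : Lp ℝ 2 vol01 × Lp ℝ 2 vol01 =>
      Real.cos (Real.pi * a) * ‖p.1‖ ^ 2) hi).inter (isClosed_le (by fun_prop : Continuous
      fun p : Lp ℝ 2 vol01 × Lp ℝ 2 vol01 => Real.cos (Real.pi * a) * ‖p.2‖ ^ 2) hi)
  have hQ2 : ∀ p ∈ Q, ∀ ψ, IsTest ψ → ∫ x, p.2 x * leftCaputo (1 - a) ψ x ∂vol01 =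
      -∫ x, p.1 x * rightCaputo (1 - a) ψ x ∂vol01 := by
    intro p hp ψ hψ
    refine closure_minimal (s := (testPairs ha : Set (Lp ℝ 2 vol01 × Lp ℝ 2 vol01)))
      (t := {p | ∫ x, p.2 x * leftCaputo (1 - a) ψ x ∂vol01 =
      -∫ x, p.1 x * rightCaputo (1 - a) ψ x ∂vol01})
      (fun q hq => testPairs_integral_caputo ha ha' hq hψ) ?_ hp
    exact isClosed_eq ((continuous_integral_mul_of_memLp (memLp_leftCaputo hb hψ)).comp
      continuous_snd) ((continuous_integral_mul_of_memLp (memLp_rightCaputo hb hψ)).comp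
      continuous_fst).neg
  have hQc : IsClosed (Q : Set (Lp ℝ 2 vol01 × Lp ℝ 2 vol01)) :=
    Submodule.isClosed_topologicalClosure _
  have : CompleteSpace Q := hQc.completeSpace_coe
  let F : Q →L[ℝ] Lp ℝ 2 vol01 := (ContinuousLinearMap.fst ℝ _ _).comp Q.subtypeL
  have hF : ∀ q : Q, ‖q‖ ≤ (max 1 (Real.cos (Real.pi * a))⁻¹).toNNReal * ‖F q‖ := by
    intro q
    rw [Real.coe_toNNReal _ (le_max_of_le_left zero_le_one)]
    change ‖(q : Lp ℝ 2 vol01 × Lp ℝ 2 vol01)‖ ≤ _ * ‖(q : Lp ℝ 2 vol01 × Lp ℝ 2 vol01).1‖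
    rw [Prod.norm_def]
    refine max_le ?_ ((norm_snd_le_of_estimate hc (hQ1 _ q.2).2).trans ?_)
    · exact le_mul_of_one_le_left (norm_nonneg _) (le_max_left _ _)
    · exact mul_le_mul_of_nonneg_right (le_max_right _ _) (norm_nonneg _)
  have hcl : IsClosed (range F) :=
    (ContinuousLinearMap.antilipschitz_of_bound F hF).isClosed_range F.uniformContinuous
  have hg : g ∈ range F := by
    have h1 : g ∈ closure ((testPairs ha).map (LinearMap.fst ℝ _ _) : Set (Lp ℝ 2 vol01)) := by
      rw [← Submodule.topologicalClosure_coe, dense_fst_testPairs ha ha']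
      trivial
    refine closure_minimal ?_ hcl h1
    rintro _ ⟨p, hp, rfl⟩
    exact ⟨⟨p, (testPairs ha).le_topologicalClosure hp⟩, rfl⟩
  obtain ⟨q, rfl⟩ := hg
  exact ⟨(q : Lp ℝ 2 vol01 × Lp ℝ 2 vol01).2, (hQ1 _ q.2).1, (hQ1 _ q.2).2, hQ2 _ q.2⟩

/-- For `b > 1/2` the point values of `I_+^b g` are bounded by the `L²`-norm of `g`. -/
theorem exists_abs_leftInt_le {b : ℝ} (hb : 1 / 2 < b) :
    ∃ K : ℝ, ∀ g : Lp ℝ 2 vol01, ∀ x ≤ 1, |leftInt b g x| ≤ K * ‖g‖ := by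
  refine ⟨√(Real.Gamma (2 * b - 1) / Real.Gamma b ^ 2 * (1 / Real.Gamma (2 * b - 1 + 1))),
    fun g x hx => ?_⟩
  obtain ⟨k, hk1, hk2⟩ := exists_inner_eq_leftInt hb hx
  rw [hk2]
  refine (abs_real_inner_le_norm _ _).trans (mul_le_mul_of_nonneg_right ?_ (norm_nonneg _))
  refine Real.le_sqrt_of_sq_le ?_
  have hΓ := Real.Gamma_pos_of_pos (s := 2 * b - 1) (by linarith)
  rw [hk1, show fracKer (2 * b) x = fracKer (2 * b - 1 + 1) x by rw [sub_add_cancel]]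
  exact mul_le_mul_of_nonneg_left (fracKer_add_one_le (by linarith) hx) (by positivity)

theorem leftInt_sub {b : ℝ} (hb : 1 / 2 < b) (g h : Lp ℝ 2 vol01) {x : ℝ} (hx : x ≤ 1) :
    leftInt b (g - h : Lp ℝ 2 vol01) x = leftInt b g x - leftInt b h x := by
  obtain ⟨k, -, hk⟩ := exists_inner_eq_leftInt hb hx
  rw [hk, hk, hk, inner_sub_right]

/-- For `b > 1/2` the fractional integral of a square-integrable function is continuous: by density
and the uniform bound of point values it suffices to see this for `I_+^a φ`, `a = 1 - b`. -/
theorem continuousOn_leftInt {a : ℝ} (ha : 0 < a) (ha' : a < 1 / 2) (g : Lp ℝ 2 vol01) :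
    ContinuousOn (leftInt (1 - a) g) (Icc 0 1) := by
  have hb : 1 / 2 < 1 - a := by linarith
  have h1 : g ∈ closure ((testPairs ha).map (LinearMap.fst ℝ _ _) : Set (Lp ℝ 2 vol01)) := by
    rw [← Submodule.topologicalClosure_coe, dense_fst_testPairs ha ha']
    trivial
  obtain ⟨u, hu, hlim⟩ := mem_closure_iff_seq_limit.1 h1
  obtain ⟨K, hK⟩ := exists_abs_leftInt_le hb
  have hunif : TendstoUniformlyOn (fun n => leftInt (1 - a) (u n)) (leftInt (1 - a) g)
      Filter.atTop (Icc 0 1) := by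
    rw [Metric.tendstoUniformlyOn_iff]
    intro ε hε
    have h2 : Filter.Tendsto (fun n => K * ‖g - u n‖) Filter.atTop (nhds 0) := by
      have := (tendsto_iff_norm_sub_tendsto_zero.1 hlim).const_mul K
      simpa [norm_sub_rev] using this
    filter_upwards [h2.eventually_lt_const hε] with n hn x hx
    rw [Real.dist_eq, ← leftInt_sub hb _ _ hx.2]
    exact (hK _ x hx.2).trans_lt hn
  refine hunif.continuousOn (.of_forall fun n => ?_)
  obtain ⟨p, ⟨φ, hφ, hp, -⟩, hpu⟩ := hu n
  have hc := hφ.1.continuous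
  have hcont : Continuous fun x => ∫ s in (0 : ℝ)..x, φ s :=
    intervalIntegral.continuous_primitive (fun _ _ => hc.intervalIntegrable _ _) 0
  refine hcont.continuousOn.congr fun x hx => ?_
  rw [← hpu]
  change leftInt (1 - a) p.1 x = _
  rw [leftInt_congr hp, leftInt_leftInt ha (by linarith) (by ring) hφ.integrable hx.2,
    leftInt_one _ hx.2, ← integral_Ioc_eq_integral_Ioo, ← intervalIntegral.integral_of_le hx.1]

/-! ### The operator taking the left to the right Caputo derivative -/

theorem ae_eq_zero_of_integral_mul_leftCaputo {a : ℝ} (ha : 0 < a) (ha' : a < 1 / 2)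
    {h : Lp ℝ 2 vol01} (hh : ∀ ψ, IsTest ψ → ∫ x, h x * leftCaputo (1 - a) ψ x ∂vol01 = 0) :
    h = 0 := by
  have hi := integrable_of_memLp_two (Lp.memLp h)
  have h1 : IsWeakRightCaputo a (fun _ => 0) h := fun ψ hψ =>
    ⟨(integral_mul_leftCaputo (by linarith) hi hψ).1, by simpa using hh ψ hψ⟩
  obtain ⟨c, hc⟩ := (isWeakRightCaputo_iff (by linarith) (integrable_zero ℝ ℝ vol01) hi).1 h1
  rw [Lp.eq_zero_iff_ae_eq_zero]
  refine ae_eq_zero_of_rightInt_ae_eq_const ha ha' (Lp.memLp h) (c := -c) ?_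
  filter_upwards [hc] with x hx
  rw [Pi.zero_apply] at hx
  linarith

/-- The bounded operator `T` on `L²(0,1)` that maps the left Caputo derivative of a function to its
right one. The bilinear form is `B(w, v) = -(D w, T (D v))`, so that coercivity of `B` is
coercivity of `-T`. -/
theorem exists_leftToRight {a : ℝ} (ha : 0 < a) (ha' : a < 1 / 2) :
    ∃ T : Lp ℝ 2 vol01 →L[ℝ] Lp ℝ 2 vol01, ∀ g,
      Real.cos (Real.pi * a) * ‖g‖ ^ 2 ≤ -inner ℝ g (T g) ∧
      ∀ ψ, IsTest ψ → ∫ x, T g x * leftCaputo (1 - a) ψ x ∂vol01 =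
        -∫ x, g x * rightCaputo (1 - a) ψ x ∂vol01 := by
  have hc : 0 < Real.cos (Real.pi * a) := cos_pi_mul_pos ha ha'
  have hb : 0 < 1 - a := by linarith
  choose T hT1 hT2 hT3 using exists_pair ha ha'
  have hint : ∀ (g : Lp ℝ 2 vol01), Integrable g vol01 := fun g =>
    integrable_of_memLp_two (Lp.memLp g)
  -- linearity holds because the partner of `g` is unique
  have hlin : ∀ g g' (c : ℝ), T (g + c • g') = T g + c • T g' := by
    intro g g' c
    rw [← sub_eq_zero]
    refine ae_eq_zero_of_integral_mul_leftCaputo ha ha' fun ψ hψ => ?_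
    have e1 : (fun x => (T (g + c • g') - (T g + c • T g')) x * leftCaputo (1 - a) ψ x) =ᵐ[vol01]
        fun x => T (g + c • g') x * leftCaputo (1 - a) ψ x -
          T g x * leftCaputo (1 - a) ψ x - c * (T g' x * leftCaputo (1 - a) ψ x) := by
      filter_upwards [Lp.coeFn_sub (T (g + c • g')) (T g + c • T g'),
        Lp.coeFn_add (T g) (c • T g'), Lp.coeFn_smul c (T g')] with x h1 h2 h3
      rw [h1, Pi.sub_apply, h2, Pi.add_apply, h3, Pi.smul_apply, smul_eq_mul]
      ring
    have e2 : (fun x => (g + c • g') x * rightCaputo (1 - a) ψ x) =ᵐ[vol01]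
        fun x => g x * rightCaputo (1 - a) ψ x + c * (g' x * rightCaputo (1 - a) ψ x) := by
      filter_upwards [Lp.coeFn_add g (c • g'), Lp.coeFn_smul c g'] with x h1 h2
      rw [h1, Pi.add_apply, h2, Pi.smul_apply, smul_eq_mul]
      ring
    have i := fun g : Lp ℝ 2 vol01 => (integral_mul_leftCaputo hb (hint g) hψ).1
    have j := fun g : Lp ℝ 2 vol01 => (integral_mul_rightCaputo hb (hint g) hψ).1
    have ij : Integrable (fun x => T (g + c • g') x * leftCaputo (1 - a) ψ x -
      T g x * leftCaputo (1 - a) ψ x) vol01 := (i _).sub (i _)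
    rw [integral_congr_ae e1, integral_sub ij ((i _).const_mul c),
      integral_sub (i _) (i _), integral_const_mul, hT3 _ ψ hψ, hT3 _ ψ hψ, hT3 _ ψ hψ,
      integral_congr_ae e2, integral_add (j _) ((j _).const_mul c), integral_const_mul]
    ring
  have hzero : T 0 = 0 := by simpa using hlin 0 0 1
  let T' : Lp ℝ 2 vol01 →ₗ[ℝ] Lp ℝ 2 vol01 :=
    { toFun := T
      map_add' := fun g g' => by simpa using hlin g g' 1
      map_smul' := fun c g => by simpa [hzero] using hlin 0 g c }
  exact ⟨T'.mkContinuous _ fun g => norm_snd_le_of_estimate hc (hT2 g),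
    fun g => ⟨hT1 g, hT3 g⟩⟩

/-! ### The structure of the Caputo space -/

section Space

variable {κ : ℝ≥0∞} [hκ : Fact (1 ≤ κ)] {a : ℝ}

theorem integrable_toFn (v : CaputoSpace κ a) : Integrable (toFn v) vol01 :=
  (Lp.memLp (toFn v)).integrable hκ.out

theorem integrable_leftD (v : CaputoSpace κ a) : Integrable (leftD v) vol01 :=
  integrable_of_memLp_two (Lp.memLp (leftD v))

theorem toFn_ae_eq (ha : a < 1) (v : CaputoSpace κ a) :
    ∃ c : ℝ, toFn v =ᵐ[vol01] fun x => leftInt (1 - a) (leftD v) x + c :=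
  (isWeakLeftCaputo_iff ha (integrable_toFn v) (integrable_leftD v)).1 v.2

theorem caputoSpace_ext {v w : CaputoSpace κ a} (h1 : toFn v = toFn w) (h2 : leftD v = leftD w) :
    v = w := by
  refine Subtype.ext ((WithLp.ofLp_injective 2) (Prod.ext h1 h2))

theorem leftD_eq_zero_of_toFn_eq_zero (ha : 0 < a) (ha' : a < 1 / 2) {v : CaputoSpace κ a}
    (hv : toFn v = 0) : leftD v = 0 := by
  obtain ⟨c, hc⟩ := toFn_ae_eq (by linarith) v
  rw [Lp.eq_zero_iff_ae_eq_zero]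
  refine ae_eq_zero_of_leftInt_ae_eq_const ha ha' (Lp.memLp _) (c := -c) ?_
  rw [hv] at hc
  filter_upwards [hc, Lp.coeFn_zero ℝ κ vol01] with x hx hx0
  rw [hx0, Pi.zero_apply] at hx
  linarith

theorem eq_of_toFn_eq (ha : 0 < a) (ha' : a < 1 / 2) {v w : CaputoSpace κ a}
    (h : toFn v = toFn w) : v = w := by
  have h1 : leftD (v - w) = 0 := leftD_eq_zero_of_toFn_eq_zero ha ha' (sub_eq_zero.2 h)
  exact caputoSpace_ext h (sub_eq_zero.1 h1)

theorem eq_smul_one_of_leftD_eq_zero (ha : a < 1) {v : CaputoSpace κ a} (hv : leftD v = 0) :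
    ∃ c : ℝ, v = c • one κ a := by
  obtain ⟨c, hc⟩ := toFn_ae_eq ha v
  refine ⟨c, caputoSpace_ext (Lp.ext ?_) (hv.trans (smul_zero c).symm)⟩
  have h0 : leftInt (1 - a) (leftD v) = fun _ => 0 := by
    ext x
    rw [hv, leftInt_congr (Lp.coeFn_zero ℝ 2 vol01)]
    simp [leftInt]
  have e : toFn (c • one κ a) = c • Lp.const κ vol01 (1 : ℝ) := rfl
  rw [e]
  filter_upwards [hc, Lp.coeFn_smul c (Lp.const κ vol01 (1 : ℝ)), Lp.coeFn_const κ vol01 (1 : ℝ)]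
    with x h1 h2 h3
  rw [h1, h2, h0, Pi.smul_apply, h3]
  simp

theorem integral_toFn_one : ∫ x, toFn (one κ a) x ∂vol01 = 1 := by
  have e : toFn (one κ a) = Lp.const κ vol01 (1 : ℝ) := rfl
  rw [e, integral_congr_ae (Lp.coeFn_const κ vol01 (1 : ℝ))]
  simp

theorem integral_toFn_add_smul (v w : CaputoSpace κ a) (c : ℝ) :
    ∫ x, toFn (v + c • w) x ∂vol01 = ∫ x, toFn v x ∂vol01 + c * ∫ x, toFn w x ∂vol01 := by
  have e : toFn (v + c • w) = toFn v + c • toFn w := rfl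
  rw [← integral_const_mul, ← integral_add (integrable_toFn v) ((integrable_toFn w).const_mul c),
    e]
  refine integral_congr_ae ?_
  filter_upwards [Lp.coeFn_add (toFn v) (c • toFn w), Lp.coeFn_smul c (toFn w)] with x h1 h2
  rw [h1, Pi.add_apply, h2, Pi.smul_apply, smul_eq_mul]

theorem eq_of_isMeanZero_of_leftD_eq (ha : a < 1) {v w : CaputoSpace κ a} (hv : IsMeanZero v)
    (hw : IsMeanZero w) (h : leftD v = leftD w) : v = w := by
  obtain ⟨c, hc⟩ := eq_smul_one_of_leftD_eq_zero ha (v := v - w) (sub_eq_zero.2 h)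
  have h1 : v = w + c • one κ a := by rw [← hc, add_sub_cancel]
  have h2 := integral_toFn_add_smul w (one κ a) c
  rw [← h1, show ∫ x, toFn v x ∂vol01 = 0 from hv, show ∫ x, toFn w x ∂vol01 = 0 from hw,
    integral_toFn_one] at h2
  rw [h1, show c = 0 by linarith, zero_smul, add_zero]

theorem exists_isContRep (ha : 0 < a) (ha' : a < 1 / 2) (v : CaputoSpace κ a) :
    ∃ w, IsContRep v w := by
  obtain ⟨c, hc⟩ := toFn_ae_eq (by linarith) v
  exact ⟨_, (continuousOn_leftInt ha ha' (leftD v)).add continuousOn_const, hc⟩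

theorem IsContRep.eqOn {v : CaputoSpace κ a} {w w' : ℝ → ℝ} (hw : IsContRep v w)
    (hw' : IsContRep v w') : EqOn w w' (Icc 0 1) := by
  have h1 : w =ᵐ[volume.restrict (Icc 0 1)] w' := by
    rw [← restrict_Ioo_eq_restrict_Icc]
    exact hw.2.symm.trans hw'.2
  exact Measure.eqOn_Icc_of_ae_eq volume zero_ne_one h1 hw.1 hw'.1

theorem IsContRep.valueAt_eq {v : CaputoSpace κ a} {w : ℝ → ℝ} (hw : IsContRep v w) {x : ℝ}
    (hx : x ∈ Icc (0 : ℝ) 1) : valueAt v x = w x := by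
  have h : ∃ w, IsContRep v w := ⟨w, hw⟩
  rw [valueAt, dif_pos h]
  exact h.choose_spec.eqOn hw hx

theorem valueAt_add_smul (ha : 0 < a) (ha' : a < 1 / 2) (v w : CaputoSpace κ a) (c : ℝ) {x : ℝ}
    (hx : x ∈ Icc (0 : ℝ) 1) : valueAt (v + c • w) x = valueAt v x + c * valueAt w x := by
  obtain ⟨r, hr⟩ := exists_isContRep ha ha' v
  obtain ⟨s, hs⟩ := exists_isContRep ha ha' w
  have h : IsContRep (v + c • w) fun x => r x + c * s x := by
    refine ⟨hr.1.add (continuousOn_const.mul hs.1), ?_⟩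
    have e : toFn (v + c • w) = toFn v + c • toFn w := rfl
    rw [e]
    filter_upwards [Lp.coeFn_add (toFn v) (c • toFn w), Lp.coeFn_smul c (toFn w), hr.2, hs.2]
      with x h1 h2 h3 h4
    rw [h1, Pi.add_apply, h2, Pi.smul_apply, smul_eq_mul, h3, h4]
  rw [h.valueAt_eq hx, hr.valueAt_eq hx, hs.valueAt_eq hx]

theorem valueAt_one {x : ℝ} (hx : x ∈ Icc (0 : ℝ) 1) : valueAt (one κ a) x = 1 := by
  have h : IsContRep (one κ a) fun _ => 1 :=
    ⟨continuousOn_const, Lp.coeFn_const κ vol01 (1 : ℝ)⟩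
  exact h.valueAt_eq hx

theorem existsUnique_hasRightD (ha : 0 < a) (ha' : a < 1 / 2) (v : CaputoSpace κ a)
    {h : Lp ℝ 2 vol01} (hh : ∀ ψ, IsTest ψ → ∫ x, h x * leftCaputo (1 - a) ψ x ∂vol01 =
      -∫ x, leftD v x * rightCaputo (1 - a) ψ x ∂vol01) :
    HasRightD v h ∧ ∀ h', HasRightD v h' → h' = h := by
  have hb : 0 < 1 - a := by linarith
  have hint := fun g : Lp ℝ 2 vol01 => integrable_of_memLp_two (Lp.memLp g)
  have h1 : HasRightD v h := fun ψ hψ => by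
    refine ⟨(integral_mul_leftCaputo hb (hint h) hψ).1, ?_⟩
    rw [hh ψ hψ, neg_eq_iff_eq_neg]
    exact (v.2 ψ hψ).2
  refine ⟨h1, fun h' hh' => ?_⟩
  rw [← sub_eq_zero]
  refine ae_eq_zero_of_integral_mul_leftCaputo ha ha' fun ψ hψ => ?_
  have e : (fun x => (h' - h) x * leftCaputo (1 - a) ψ x) =ᵐ[vol01]
      fun x => h' x * leftCaputo (1 - a) ψ x - h x * leftCaputo (1 - a) ψ x := by
    filter_upwards [Lp.coeFn_sub h' h] with x hx
    rw [hx, Pi.sub_apply, sub_mul]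
  rw [integral_congr_ae e, integral_sub (hh' ψ hψ).1 (h1 ψ hψ).1, (hh' ψ hψ).2, (h1 ψ hψ).2,
    sub_self]

theorem rightD_eq {v : CaputoSpace κ a} {h : Lp ℝ 2 vol01} (h1 : HasRightD v h)
    (h2 : ∀ h', HasRightD v h' → h' = h) : rightD v = h := by
  have h3 : ∃ g, HasRightD v g := ⟨h, h1⟩
  rw [rightD, dif_pos h3]
  exact h2 _ h3.choose_spec

/-- A bounded right inverse of the left Caputo derivative: `E g` is `I_+^{1-a} g` minus its mean.
Its values at points of `[0,1]` are bounded, too. -/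
theorem exists_rightInverse (κ : ℝ≥0∞) [hκ : Fact (1 ≤ κ)] (ha : 0 < a) (ha' : a < 1 / 2) :
    ∃ (E : Lp ℝ 2 vol01 →ₗ[ℝ] CaputoSpace κ a) (K : ℝ), 0 < K ∧ ∀ g, leftD (E g) = g ∧
      IsMeanZero (E g) ∧ ‖E g‖ ≤ K * ‖g‖ ∧ ∀ x ∈ Icc (0 : ℝ) 1, |valueAt (E g) x| ≤ K * ‖g‖ := by
  have hb : 1 / 2 < 1 - a := by linarith
  obtain ⟨K, hK⟩ := exists_abs_leftInt_le hb
  have hint := fun g : Lp ℝ 2 vol01 => integrable_of_memLp_two (Lp.memLp g)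
  have hI := fun g : Lp ℝ 2 vol01 => integrable_leftInt (by linarith : 0 < 1 - a) (hint g)
  let m : Lp ℝ 2 vol01 → ℝ := fun g => ∫ x, leftInt (1 - a) g x ∂vol01
  have hm : ∀ g, |m g| ≤ K * ‖g‖ := by
    intro g
    have h := norm_integral_le_of_norm_le (μ := vol01) (f := leftInt (1 - a) g)
      (g := fun _ => K * ‖g‖) (integrable_const _) (by
        filter_upwards [ae_restrict_mem measurableSet_Ioo] with x hx
        exact hK g x hx.2.le)
    simpa using h
  have hV : ∀ (g : Lp ℝ 2 vol01), ∀ x ≤ 1, |leftInt (1 - a) g x - m g| ≤ 2 * K * ‖g‖ := by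
    intro g x hx
    refine (abs_sub _ _).trans ?_
    linarith [hK g x hx, hm g]
  have hVae : ∀ g : Lp ℝ 2 vol01,
      ∀ᵐ x ∂vol01, ‖leftInt (1 - a) g x - m g‖ ≤ 2 * K * ‖g‖ := by
    intro g
    filter_upwards [ae_restrict_mem measurableSet_Ioo] with x hx
    exact hV g x hx.2.le
  have hVm : ∀ g : Lp ℝ 2 vol01, MemLp (fun x => leftInt (1 - a) g x - m g) κ vol01 := fun g =>
    .of_bound ((hI g).1.sub aestronglyMeasurable_const) (2 * K * ‖g‖) (hVae g)
  let E₀ : Lp ℝ 2 vol01 → CaputoSpace κ a := fun g =>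
    ⟨WithLp.toLp 2 ((hVm g).toLp _, g),
      (isWeakLeftCaputo_iff (by linarith) (((hVm g).ae_eq
        (hVm g).coeFn_toLp.symm).integrable hκ.out) (hint g)).2
        ⟨-m g, by
          filter_upwards [(hVm g).coeFn_toLp] with x hx
          rw [← sub_eq_add_neg]
          exact hx⟩⟩
  have hD : ∀ g, leftD (E₀ g) = g := fun g => rfl
  have hF : ∀ g, toFn (E₀ g) =ᵐ[vol01] fun x => leftInt (1 - a) g x - m g := fun g =>
    (hVm g).coeFn_toLp
  have hM : ∀ g, IsMeanZero (E₀ g) := by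
    intro g
    rw [IsMeanZero, integral_congr_ae (hF g), integral_sub (hI g) (integrable_const _)]
    simp [m]
  have hlin : ∀ g h (c : ℝ), E₀ (g + c • h) = E₀ g + c • E₀ h := fun g h c => by
    refine eq_of_isMeanZero_of_leftD_eq (by linarith) (hM _) ?_ rfl
    rw [IsMeanZero, integral_toFn_add_smul, show ∫ x, toFn (E₀ g) x ∂vol01 = 0 from hM g,
      show ∫ x, toFn (E₀ h) x ∂vol01 = 0 from hM h, mul_zero, add_zero]
  have hzero : E₀ 0 = 0 := by
    have := hlin 0 0 1
    simpa using this
  let E : Lp ℝ 2 vol01 →ₗ[ℝ] CaputoSpace κ a :=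
    { toFun := E₀
      map_add' := fun g h => by simpa using hlin g h 1
      map_smul' := fun c h => by simpa [hzero] using hlin 0 h c }
  refine ⟨E, 2 * |K| + 1, by positivity, fun g => ⟨hD g, hM g, ?_, fun x hx => ?_⟩⟩
  · change ‖E₀ g‖ ≤ _
    have hn : ‖toFn (E₀ g)‖ ≤ 2 * |K| * ‖g‖ := by
      have h2 := Lp.norm_le_of_ae_bound (f := toFn (E₀ g)) (C := 2 * |K| * ‖g‖) (by positivity) (by
        filter_upwards [hF g, hVae g] with x h1 h2
        rw [h1]
        refine h2.trans ?_
        gcongr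
        exact le_abs_self K)
      have hμ : measureUnivNNReal vol01 = 1 := by simp [measureUnivNNReal]
      simpa [hμ] using h2
    rw [norm_eq, hD]
    refine Real.sqrt_le_iff.2 ⟨by positivity, ?_⟩
    nlinarith [norm_nonneg (toFn (E₀ g)), norm_nonneg g,
      mul_nonneg (abs_nonneg K) (norm_nonneg g), pow_le_pow_left₀ (norm_nonneg _) hn 2]
  · have hr : IsContRep (E₀ g) fun x => leftInt (1 - a) g x - m g :=
      ⟨(continuousOn_leftInt ha ha' g).sub continuousOn_const, hF g⟩
    change |valueAt (E₀ g) x| ≤ _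
    rw [hr.valueAt_eq hx]
    refine (hV g x hx.2).trans ?_
    nlinarith [mul_le_mul_of_nonneg_right (le_abs_self K) (norm_nonneg g), norm_nonneg g]

end Space

/-! ### Well-posedness -/

/-- A form of the Lax–Milgram theorem with the operator in the second argument. -/
theorem exists_lax_milgram {V : Type*} [NormedAddCommGroup V] [InnerProductSpace ℝ V]
    [CompleteSpace V] {T : V →L[ℝ] V} {c : ℝ} (hc : 0 < c)
    (hT : ∀ g, c * ‖g‖ ^ 2 ≤ -inner ℝ g (T g)) (L : V →L[ℝ] ℝ) :
    ∃ u : V, (∀ g, -inner ℝ u (T g) = L g) ∧ ‖u‖ ≤ c⁻¹ * ‖L‖ := by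
  let B₀ : V →ₗ[ℝ] V →ₗ[ℝ] ℝ := LinearMap.mk₂ ℝ (fun u g => -inner ℝ u (T g))
    (fun u v g => by rw [inner_add_left, neg_add])
    (fun r u g => by rw [real_inner_smul_left, smul_eq_mul, mul_neg])
    (fun u g h => by rw [map_add, inner_add_right, neg_add])
    (fun r u g => by rw [map_smul, real_inner_smul_right, smul_eq_mul, mul_neg])
  let B : V →L[ℝ] V →L[ℝ] ℝ := B₀.mkContinuous₂ ‖T‖ fun u g => by
    change ‖-inner ℝ u (T g)‖ ≤ _
    rw [norm_neg]
    calc ‖inner ℝ u (T g)‖ ≤ ‖u‖ * ‖T g‖ := norm_inner_le_norm _ _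
      _ ≤ ‖u‖ * (‖T‖ * ‖g‖) := by gcongr; exact T.le_opNorm g
      _ = ‖T‖ * ‖u‖ * ‖g‖ := by ring
  have hB : IsCoercive B := ⟨c, hc, fun u => by
    rw [mul_assoc, ← sq]
    exact hT u⟩
  let u := hB.continuousLinearEquivOfBilin.symm ((InnerProductSpace.toDual ℝ V).symm L)
  have hu : ∀ g, -inner ℝ u (T g) = L g := fun g => by
    have h := hB.continuousLinearEquivOfBilin_apply u g
    rw [ContinuousLinearEquiv.apply_symm_apply, InnerProductSpace.toDual_symm_apply] at h
    exact h.symm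
  refine ⟨u, hu, ?_⟩
  have h1 : c * ‖u‖ ^ 2 ≤ ‖L‖ * ‖u‖ :=
    (hT u).trans ((hu u).le.trans ((le_abs_self _).trans (L.le_opNorm u)))
  rcases (norm_nonneg u).eq_or_lt with h0 | h0
  · rw [← h0]; positivity
  · rw [inv_mul_eq_div, le_div_iff₀ hc]
    have : (‖u‖ * c) * ‖u‖ ≤ ‖L‖ * ‖u‖ := by nlinarith
    exact le_of_mul_le_mul_right this h0

end ConservativeCaputo

open ConservativeCaputo in
theorem mainTheorem6 (β : ℝ) (hβ₀ : 0 < β) (hβ₁ : β < 1)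
    (κ : ℝ≥0∞) [Fact (1 ≤ κ)] (hκ : κ ≤ 2) :
    -- the form and the functional are well defined: the function determines its left Caputo
    -- derivative, and its right Caputo derivative and its continuous representative exist
    (∀ v w : CaputoSpace κ (β / 2), toFn v = toFn w → v = w) ∧
    (∀ v : CaputoSpace κ (β / 2), (∃! h, HasRightD v h) ∧ ∃ w, IsContRep v w) ∧
    -- coercivity
    (∀ w : CaputoSpace κ (β / 2),
      Real.cos (β * Real.pi / 2) * ‖leftD w‖ ^ 2 ≤ formB w w) ∧
    -- well-posedness
    ∃ C : ℝ, 0 < C ∧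
      ∀ (f : CaputoSpace κ (β / 2) →L[ℝ] ℝ) (a₀ a₁ : ℝ),
        f (one κ (β / 2)) + a₁ - a₀ = 0 →
        ∃ u : CaputoSpace κ (β / 2),
          (IsMeanZero u ∧ IsWeakSolution f a₀ a₁ u) ∧
          (∀ u' : CaputoSpace κ (β / 2),
            IsMeanZero u' → IsWeakSolution f a₀ a₁ u' → u' = u) ∧
          ‖u‖ ≤ C * (‖f‖ + |a₀| + |a₁|) ∧
          ∀ u' : CaputoSpace κ (β / 2),
            IsWeakSolution f a₀ a₁ u' ↔ ∃ c : ℝ, u' = u + c • one κ (β / 2) := by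
  have ha : 0 < β / 2 := by linarith
  have ha' : β / 2 < 1 / 2 := by linarith
  have hcos : β * Real.pi / 2 = Real.pi * (β / 2) := by ring
  have hc : 0 < Real.cos (Real.pi * (β / 2)) := cos_pi_mul_pos ha ha'
  obtain ⟨T, hT⟩ := exists_leftToRight ha ha'
  have hR := fun v : CaputoSpace κ (β / 2) =>
    existsUnique_hasRightD ha ha' v (hT (leftD v)).2
  have hform : ∀ w v : CaputoSpace κ (β / 2), formB w v = -inner ℝ (leftD w) (T (leftD v)) :=
    fun w v => by rw [formB, rightD_eq (hR v).1 (hR v).2]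
  refine ⟨fun v w => eq_of_toFn_eq ha ha', fun v => ⟨⟨_, (hR v).1, (hR v).2⟩,
    exists_isContRep ha ha' v⟩, fun w => ?_, ?_⟩
  · rw [hform, hcos]
    exact (hT _).1
  obtain ⟨E, K, hK, hE⟩ := exists_rightInverse κ ha ha'
  refine ⟨K * ((Real.cos (Real.pi * (β / 2)))⁻¹ * K), by positivity, fun f a₀ a₁ hf => ?_⟩
  have h0 : (0 : ℝ) ∈ Icc (0 : ℝ) 1 := by simp
  have h1 : (1 : ℝ) ∈ Icc (0 : ℝ) 1 := by simp
  -- the right-hand side of the weak formulation, which vanishes on constants, as a functional of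
  -- the left derivative
  let ℓ : CaputoSpace κ (β / 2) → ℝ := fun v => f v + a₁ * valueAt v 1 - a₀ * valueAt v 0
  have hℓ : ∀ v w (c : ℝ), ℓ (v + c • w) = ℓ v + c * ℓ w := fun v w c => by
    simp only [ℓ, valueAt_add_smul ha ha' v w c h0, valueAt_add_smul ha ha' v w c h1, map_add,
      map_smul, smul_eq_mul]
    ring
  have hℓ0 : ℓ 0 = 0 := by simpa using hℓ 0 0 1
  have hℓ1 : ℓ (one κ (β / 2)) = 0 := by
    simp only [ℓ, valueAt_one h0, valueAt_one h1]
    linarith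
  let L₀ : Lp ℝ 2 vol01 →ₗ[ℝ] ℝ :=
    { toFun := fun g => ℓ (E g)
      map_add' := fun g h => by simpa using hℓ (E g) (E h) 1
      map_smul' := fun c g => by simpa [hℓ0] using hℓ 0 (E g) c }
  have hL₀ : ∀ g, ‖L₀ g‖ ≤ K * (‖f‖ + |a₀| + |a₁|) * ‖g‖ := fun g => by
    obtain ⟨-, -, hE1, hE2⟩ := hE g
    have e1 : |f (E g)| ≤ ‖f‖ * (K * ‖g‖) := (f.le_opNorm _).trans (by gcongr)
    have e2 : |a₁ * valueAt (E g) 1| ≤ |a₁| * (K * ‖g‖) := by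
      rw [abs_mul]; gcongr; exact hE2 1 h1
    have e3 : |a₀ * valueAt (E g) 0| ≤ |a₀| * (K * ‖g‖) := by
      rw [abs_mul]; gcongr; exact hE2 0 h0
    calc |f (E g) + a₁ * valueAt (E g) 1 - a₀ * valueAt (E g) 0|
        ≤ |f (E g)| + |a₁ * valueAt (E g) 1| + |a₀ * valueAt (E g) 0| :=
          (abs_sub _ _).trans (add_le_add_left (abs_add_le _ _) _)
      _ ≤ K * (‖f‖ + |a₀| + |a₁|) * ‖g‖ := by linarith
  obtain ⟨g₀, hg₀, hg₀n⟩ := exists_lax_milgram hc (fun g => (hT g).1) (L₀.mkContinuous _ hL₀)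
  have hL : ∀ g, -inner ℝ g₀ (T g) = ℓ (E g) := hg₀
  have hsplit : ∀ v : CaputoSpace κ (β / 2), ∃ c : ℝ, v = E (leftD v) + c • one κ (β / 2) :=
    fun v => by
      obtain ⟨c, hcv⟩ := eq_smul_one_of_leftD_eq_zero (by linarith) (v := v - E (leftD v))
        (sub_eq_zero.2 (hE (leftD v)).1.symm)
      exact ⟨c, by rw [← hcv, add_sub_cancel]⟩
  have hsol : ∀ u, IsWeakSolution f a₀ a₁ u ↔ leftD u = g₀ := fun u => by
    constructor
    · intro hu
      have h2 : ∀ g, inner ℝ (leftD u - g₀) (T g) = 0 := fun g => by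
        have h3 := hu (E g)
        rw [hform, (hE g).1] at h3
        have h4 := hL g
        rw [inner_sub_left]
        simp only [ℓ] at h4
        linarith
      have h5 := (hT (leftD u - g₀)).1
      rw [h2, neg_zero] at h5
      have h6 : ‖leftD u - g₀‖ ^ 2 ≤ 0 := by
        by_contra h
        exact absurd h5 (not_le.2 (mul_pos hc (not_le.1 h)))
      exact sub_eq_zero.1 (norm_eq_zero.1 (pow_eq_zero_iff two_ne_zero |>.1
        (le_antisymm h6 (sq_nonneg _))))
    · intro hu v
      obtain ⟨c, hv⟩ := hsplit v
      have h2 : ℓ v = ℓ (E (leftD v)) := by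
        conv_lhs => rw [hv, hℓ, hℓ1, mul_zero, add_zero]
      rw [hform, hu, hL, ← h2]
  refine ⟨E g₀, ⟨(hE g₀).2.1, (hsol _).2 (hE g₀).1⟩, fun u' hu'm hu' => ?_, ?_, fun u' => ?_⟩
  · exact eq_of_isMeanZero_of_leftD_eq (by linarith) hu'm (hE g₀).2.1
      (((hsol u').1 hu').trans (hE g₀).1.symm)
  · calc ‖E g₀‖ ≤ K * ‖g₀‖ := (hE g₀).2.2.1
      _ ≤ K * ((Real.cos (Real.pi * (β / 2)))⁻¹ * (K * (‖f‖ + |a₀| + |a₁|))) := by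
        gcongr
        refine hg₀n.trans ?_
        gcongr
        exact LinearMap.mkContinuous_norm_le _ (by positivity) _
      _ = K * ((Real.cos (Real.pi * (β / 2)))⁻¹ * K) * (‖f‖ + |a₀| + |a₁|) := by ring
  · rw [hsol]
    constructor
    · intro hu
      obtain ⟨c, hc'⟩ := hsplit u'
      exact ⟨c, by rw [← hu]; exact hc'⟩
    · rintro ⟨c, rfl⟩
      have e : leftD (E g₀ + c • one κ (β / 2)) = leftD (E g₀) + c • (0 : Lp ℝ 2 vol01) := rfl
      rw [e, smul_zero, add_zero, (hE g₀).1]
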